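/- All matroids are finite. For a matroid $N$ on a set $E(N)$ with rank function $r_N$, let $$T(N;x,y)=\sum_{S\subseteq E(N)}(x-1)^{r_N(E(N))-r_N(S)}(y-1)^{|S|-r_N(S)}$$ be its Tutte polynomial. A cyclic flat of $N$ is a flat $F$ of $N$ such that the restriction $N|F$ has no coloops. The size-rank-coloop data of $N$ is the multiset of the triples $(|S|,r_N(S),c(S))$, one for each subset $S\subseteq E(N)$, where $c(S)$ is the number of coloops of $N|S$. Let $M$ be a loopless matroid on $E$ with rank function $r$, and let $m\ge 1$ be an integer. For each $e\in E$ let $T_e$ be a set of size $m$, where the sets $T_e$ are disjoint from each other and from $E$, and let $a$ be an element that is neither in $E$ nor in any $T_e$. For $S\subseteq E$ put $q(S)=S\cup\{a\}\cup\bigcup_{e\in S}T_e$. The free $m$-cone $Q_m(M)$ is the matroid on $q(E)$ whose cyclic flats are the cyclic flats $Z$ of $M$, with rank $r(Z)$, and the sets $q(F)$ for the nonempty flats $F$ of $M$, with rank $r(F)+1$. Theorem. For every $m\ge 1$ and every loopless matroid $M$, there is exactly one such matroid $Q_m(M)$, and its Tutte polynomial $T(Q_m(M);x,y)$ can be computed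 from $m$ and the size-rank-coloop data of $M$. That is, there is a computable function that, for all $m\ge 1$ and all loopless $M$, given $m$ and any list of the size-rank-coloop data of $M$, returns $T(Q_m(M);x,y)$ as a finite list of terms $c\,x^iy^j$ with $c\in\mathbb{Z}$. -/

import Mathlib

namespace Matroid

/-- A cyclic flat of `M`: a flat `F` such that the restriction of `M` to `F` has no coloops. -/
def IsCyclicFlat {α : Type*} (M : Matroid α) (F : Set α) : Prop :=
  M.IsFlat F ∧ (M ↾ F).coloops = ∅

/-- The rank of a set as a natural number. It is used for finite matroids only. -/
noncomputable def natRk {α : Type*} (M : Matroid α) (S : Set α) : ℕ := (M.eRk S).toNat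

/-- The Tutte polynomial
`T(M; x, y) = ∑_{S ⊆ E} (x - 1) ^ (r(E) - r(S)) * (y - 1) ^ (|S| - r(S))`
of a finite matroid, with `x = X 0` and `y = X 1`. The subtractions of natural numbers are
exact, since `r(S) ≤ r(E)` and `r(S) ≤ |S|`. -/
noncomputable def tuttePoly {α : Type*} (M : Matroid α) [M.Finite] : MvPolynomial (Fin 2) ℤ :=
  ∑ S ∈ M.ground_finite.toFinset.powerset,
    (MvPolynomial.X 0 - 1) ^ (M.natRk M.E - M.natRk (S : Set α)) *
      (MvPolynomial.X 1 - 1) ^ (S.card - M.natRk (S : Set α))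

/-- The size-rank-coloop data of a finite matroid: the multiset of the triples
`(|S|, r(S), c(S))`, one for each subset `S` of the ground set, where `c(S)` is the number of
coloops of the restriction of `M` to `S`. -/
noncomputable def sizeRankColoopData {α : Type*} (M : Matroid α) [M.Finite] :
    Multiset (ℕ × ℕ × ℕ) :=
  M.ground_finite.toFinset.powerset.val.map fun S : Finset α =>
    (S.card, M.natRk (S : Set α), (M ↾ (S : Set α)).coloops.ncard)

/-- The elements from which free `m`-cones are made: the original elements `base e`, the `m`
elements `copy e i` of the set `T_e` for each `e`, and the tip. -/
inductive ConeElt (α : Type*) (m : ℕ) where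
  | base (e : α)
  | copy (e : α) (i : Fin m)
  | tip

/-- The cone `q(S) = S ∪ {a} ∪ ⋃_{e ∈ S} T_e` of a set `S`, where `a` is the tip. -/
def coneSet {α : Type*} (m : ℕ) (S : Set α) : Set (ConeElt α m) :=
  (ConeElt.base '' S ∪ {ConeElt.tip}) ∪ ⋃ e ∈ S, Set.range (ConeElt.copy e)

/-- `Q` is the free `m`-cone of `M`: the matroid on `E ∪ T ∪ {a}` whose cyclic flats are the
cyclic flats of `M`, of the same rank as in `M`, and the cones `q(F)` of the nonempty flats `F`
of `M`, of rank `r(F) + 1`. -/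
structure IsFreeCone {α : Type*} (m : ℕ) (M : Matroid α) (Q : Matroid (ConeElt α m)) : Prop where
  ground_eq : Q.E = coneSet m M.E
  isCyclicFlat_iff : ∀ Z : Set (ConeElt α m), Q.IsCyclicFlat Z ↔
    (∃ F, M.IsCyclicFlat F ∧ Z = ConeElt.base '' F) ∨
      (∃ F, M.IsFlat F ∧ F.Nonempty ∧ Z = coneSet m F)
  eRk_base : ∀ F, M.IsCyclicFlat F → Q.eRk (ConeElt.base '' F) = M.eRk F
  eRk_cone : ∀ F, M.IsFlat F → F.Nonempty → Q.eRk (coneSet m F) = M.eRk F + 1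

/-- The free `m`-cone of a finite matroid is finite, so that its Tutte polynomial makes sense. -/
theorem IsFreeCone.finite {α : Type*} {m : ℕ} {M : Matroid α} [M.Finite]
    {Q : Matroid (ConeElt α m)} (hQ : IsFreeCone m M Q) : Q.Finite := by
  refine ⟨?_⟩
  rw [hQ.ground_eq, coneSet]
  exact ((M.ground_finite.image _).union (Set.finite_singleton _)).union
    (M.ground_finite.biUnion fun e _ => Set.finite_range _)

/-- The polynomial `∑ c * x ^ i * y ^ j` written out as a finite list of terms `(i, j, c)`. -/
noncomputable def polyOfTerms (L : List (ℕ × ℕ × ℤ)) : MvPolynomial (Fin 2) ℤ :=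
  (L.map fun t => MvPolynomial.C t.2.2 * MvPolynomial.X 0 ^ t.1 * MvPolynomial.X 1 ^ t.2.1).sum

end Matroid

/-!
A finite matroid is determined by its cyclic flats and their ranks, because
`r(X) = r(Z) + |X \ Z|` for the cyclic flat `Z` spanned by the elements of `X` that are not coloops
of `M ↾ X` (`Matroid.ext_isCyclicFlat`). So there is at most one free cone, and its rank function
has to be the minimum of `r(Z) + |X \ Z|` over the prescribed cyclic flats `Z`. If `S` is the
support of `X`, the set of all `e` such that `X` contains `e` or a member of `T_e`, this minimum is
`min (r(S) + 1) (r(X ∩ E) + |X \ E|)` (`Matroid.coneRk`). This function is monotone, submodular and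
at most `|X|`, so it is the rank function of a matroid (`Matroid.IsRankFn.matroid`), and the cyclic
flats of that matroid are the prescribed ones (`Matroid.isFreeCone_freeCone`).

For the Tutte polynomial, the subsets `X` of `q(E)` are grouped by their support `S`. Always
`r(S) ≤ r(X ∩ E) + |X \ E|`, so that the rank of `X` is `r(S)` or `r(S) + 1`. It is `r(S)` exactly
if `X` consists of one element over each `e ∈ S`, and this is `e` itself unless `e` is a coloop of
`M ↾ S`; there are `(m + 1) ^ c(S)` such sets, all of size `|S|` (`Matroid.card_filter_coneRk_eq`).
The sizes of all sets with support `S` have the generating function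
`(1 + z) * ((1 + z) ^ (m + 1) - 1) ^ |S|` (`Matroid.sum_coneFiber_pow_card`). Hence the contribution
of `S` depends only on `m`, the rank of `M`, `|S|`, `r(S)` and `c(S)` (`Matroid.sum_coneFiber`), and
the rank of `M` is the largest rank in the data.

The contribution contains a division by `y - 1`, which is carried out by a recursion
(`Matroid.powQuot`). The resulting formula is evaluated on lists of signed monomials, with
operations on lists that are primitive recursive (`Matroid.computable₂_coneTutteTerms`).
-/

namespace Matroid

open Set

/-! ### Cyclic flats determine a finite matroid -/

section CyclicFlat

variable {α : Type*} {M : Matroid α} {X K : Set α}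

theorem eRk_diff_add_encard_of_subset_coloops (hX : X ⊆ M.E) (hK : K ⊆ (M ↾ X).coloops) :
    M.eRk (X \ K) + K.encard = M.eRk X := by
  have hKX : K ⊆ X := hK.trans (coloops_subset_ground _)
  refine le_antisymm ?_ ?_
  · obtain ⟨I, hI⟩ := M.exists_isBasis (X \ K) (sdiff_subset.trans hX)
    have hIX : (M ↾ X).Indep I := restrict_indep_iff.2 ⟨hI.indep, hI.subset.trans sdiff_subset⟩
    have hIK : (M ↾ X).Indep (I ∪ K) := (union_indep_iff_indep_of_subset_coloops hK).2 hIX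
    have hdj : Disjoint I K := disjoint_of_subset_left hI.subset disjoint_sdiff_left
    rw [← hI.encard_eq_eRk, ← encard_union_eq hdj]
    exact hIK.of_restrict.encard_le_eRk_of_subset (restrict_indep_iff.1 hIK).2
  · calc M.eRk X = M.eRk (X \ K ∪ K) := by rw [sdiff_union_of_subset hKX]
      _ ≤ _ := M.eRk_union_le_eRk_add_encard _ _

theorem coloops_restrict_eq_empty_iff (hX : X ⊆ M.E) :
    (M ↾ X).coloops = ∅ ↔ ∀ e ∈ X, e ∈ M.closure (X \ {e}) := by
  simp only [eq_empty_iff_forall_notMem, ← isColoop_iff_mem_coloops, restrict_isColoop_iff hX]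
  exact forall_congr' fun e => by tauto

/-- Every set `X` has a cyclic flat `Z` at which the bound `r(X) ≤ r(Z) + |X \ Z|` is attained,
namely the closure of `X` without the coloops of `M ↾ X`. -/
theorem exists_isCyclicFlat_eRk_add_encard_diff (hX : X ⊆ M.E) :
    ∃ Z, M.IsCyclicFlat Z ∧ M.eRk Z + (X \ Z).encard = M.eRk X := by
  set K := (M ↾ X).coloops with hK
  have hKX : K ⊆ X := coloops_subset_ground _
  have hYE : X \ K ⊆ M.E := sdiff_subset.trans hX
  have hY : ∀ e ∈ X \ K, e ∈ M.closure ((X \ K) \ {e}) := by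
    rintro e ⟨heX, heK⟩
    obtain ⟨C, hC, heC⟩ := exists_mem_isCircuit_of_not_isColoop (M := M ↾ X) heX heK
    have hCK := hC.disjoint_coloops
    obtain ⟨hC', hCX⟩ := (restrict_isCircuit_iff hX).1 hC
    refine M.closure_subset_closure (sdiff_subset_sdiff_left ?_)
      (hC'.mem_closure_sdiff_singleton_of_mem heC)
    exact subset_sdiff.2 ⟨hCX, hCK⟩
  have hYcl : X \ K ⊆ M.closure (X \ K) := M.subset_closure _ hYE
  refine ⟨M.closure (X \ K), ⟨isFlat_closure _, ?_⟩, ?_⟩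
  · rw [coloops_restrict_eq_empty_iff (M.closure_subset_ground _)]
    intro e he
    by_cases heY : e ∈ X \ K
    · exact M.closure_subset_closure (sdiff_subset_sdiff_left hYcl) (hY e heY)
    · exact M.closure_subset_closure (subset_sdiff_singleton hYcl heY) he
  · have hXZ : X \ M.closure (X \ K) = K := by
      ext e
      refine ⟨fun ⟨heX, he⟩ => by_contra fun heK => he (hYcl ⟨heX, heK⟩), fun he => ⟨hKX he, ?_⟩⟩
      have he' := ((restrict_isColoop_iff hX).1 he).1
      exact fun h => he' (M.closure_subset_closure
        (subset_sdiff_singleton sdiff_subset fun h' => h'.2 he) h)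
    rw [hXZ, eRk_closure_eq, eRk_diff_add_encard_of_subset_coloops hX subset_rfl]

/-- A set is independent if and only if no cyclic flat is too small for its part in it; the cyclic
flats that matter are those of `exists_isCyclicFlat_eRk_add_encard_diff`. -/
theorem indep_iff_forall_isCyclicFlat [M.Finite] (hX : X ⊆ M.E) :
    M.Indep X ↔ ∀ Z, M.IsCyclicFlat Z → (X ∩ Z).encard ≤ M.eRk Z := by
  refine ⟨fun h Z _ => (h.subset inter_subset_left).encard_le_eRk_of_subset inter_subset_right,
    fun h => ?_⟩
  obtain ⟨Z, hZ, hXZ⟩ := exists_isCyclicFlat_eRk_add_encard_diff hX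
  rw [indep_iff_eRk_eq_encard]
  refine le_antisymm (M.eRk_le_encard X) ?_
  rw [← hXZ, ← encard_sdiff_add_encard_inter X Z, add_comm]
  exact add_le_add_left (h Z hZ) _

/-- A finite matroid is determined by its cyclic flats and their ranks. -/
theorem ext_isCyclicFlat {M₁ M₂ : Matroid α} [M₁.Finite] [M₂.Finite] (hE : M₁.E = M₂.E)
    (hZ : ∀ Z, M₁.IsCyclicFlat Z ↔ M₂.IsCyclicFlat Z)
    (hr : ∀ Z, M₁.IsCyclicFlat Z → M₁.eRk Z = M₂.eRk Z) : M₁ = M₂ := by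
  refine ext_indep hE fun I hI => ?_
  rw [indep_iff_forall_isCyclicFlat hI, indep_iff_forall_isCyclicFlat (hE ▸ hI)]
  exact ⟨fun h Z h₂ => hr Z ((hZ Z).2 h₂) ▸ h Z ((hZ Z).2 h₂),
    fun h Z h₁ => hr Z h₁ ▸ h Z ((hZ Z).1 h₁)⟩

end CyclicFlat

/-! ### Natural-number rank -/

section NatRk

variable {α : Type*} {M : Matroid α} {X Y K : Set α} {e : α}

theorem coe_natRk (M : Matroid α) [M.Finite] (X : Set α) : (M.natRk X : ℕ∞) = M.eRk X :=
  ENat.natCast_toNat (eRk_ne_top_iff.2 (M.isRkFinite_set X))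

theorem natRk_mono (M : Matroid α) [M.Finite] (h : X ⊆ Y) : M.natRk X ≤ M.natRk Y := by
  have := M.eRk_mono h
  rw [← coe_natRk, ← coe_natRk] at this
  exact_mod_cast this

theorem natRk_inter_add_natRk_union_le (M : Matroid α) [M.Finite] (X Y : Set α) :
    M.natRk (X ∩ Y) + M.natRk (X ∪ Y) ≤ M.natRk X + M.natRk Y := by
  have := M.eRk_inter_add_eRk_union_le X Y
  simp only [← coe_natRk] at this
  exact_mod_cast this

@[simp]
theorem natRk_empty (M : Matroid α) : M.natRk ∅ = 0 := by simp [natRk]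

theorem natRk_le_ncard (M : Matroid α) [M.Finite] (hX : X.Finite) : M.natRk X ≤ X.ncard := by
  have := M.eRk_le_encard X
  rw [← coe_natRk, ← hX.cast_ncard_eq] at this
  exact_mod_cast this

theorem natRk_union_le_add_ncard (M : Matroid α) [M.Finite] (X : Set α) (hY : Y.Finite) :
    M.natRk (X ∪ Y) ≤ M.natRk X + Y.ncard := by
  have h₁ := M.natRk_inter_add_natRk_union_le X Y
  have h₂ := M.natRk_le_ncard hY
  omega

theorem natRk_insert_le (M : Matroid α) [M.Finite] (e : α) (X : Set α) :
    M.natRk (insert e X) ≤ M.natRk X + 1 := by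
  have := M.natRk_union_le_add_ncard X (finite_singleton e)
  rwa [union_singleton, ncard_singleton] at this

theorem natRk_closure (M : Matroid α) (X : Set α) : M.natRk (M.closure X) = M.natRk X := by
  simp [natRk]

theorem natRk_diff_add_ncard_of_subset_coloops [M.Finite] (hX : X ⊆ M.E)
    (hK : K ⊆ (M ↾ X).coloops) : M.natRk (X \ K) + K.ncard = M.natRk X := by
  have h := eRk_diff_add_encard_of_subset_coloops hX hK
  have hKfin : K.Finite := M.ground_finite.subset
    (hK.trans ((coloops_subset_ground (M ↾ X)).trans hX))
  rw [← coe_natRk, ← coe_natRk, ← hKfin.cast_ncard_eq] at h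
  exact_mod_cast h

theorem mem_closure_iff_natRk [M.Finite] (he : e ∈ M.E) :
    e ∈ M.closure X ↔ M.natRk (insert e X) = M.natRk X := by
  refine ⟨fun h => ?_, fun h => by_contra fun h' => ?_⟩
  · rw [← natRk_closure, closure_insert_eq_of_mem_closure h, natRk_closure]
  · have h₁ := M.eRk_insert_eq_add_one ⟨he, h'⟩
    rw [← coe_natRk, ← coe_natRk, h] at h₁
    have : M.natRk X = M.natRk X + 1 := by exact_mod_cast h₁
    omega

theorem isFlat_iff_natRk [M.Finite] {F : Set α} :
    M.IsFlat F ↔ F ⊆ M.E ∧ ∀ e ∈ M.E \ F, M.natRk (insert e F) ≠ M.natRk F := by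
  rw [isFlat_iff_closure_eq]
  constructor
  · intro h
    refine ⟨h ▸ M.closure_subset_ground F, fun e he h' => he.2 ?_⟩
    rw [← h]
    exact (mem_closure_iff_natRk he.1).2 h'
  · rintro ⟨hF, h⟩
    refine (M.subset_closure F).antisymm' fun e he => by_contra fun heF => ?_
    have heE := M.closure_subset_ground F he
    exact h e ⟨heE, heF⟩ ((mem_closure_iff_natRk heE).1 he)

theorem isCyclicFlat_iff_natRk [M.Finite] {F : Set α} :
    M.IsCyclicFlat F ↔ M.IsFlat F ∧ ∀ e ∈ F, M.natRk (F \ {e}) = M.natRk F := by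
  refine and_congr_right fun hF => ?_
  rw [coloops_restrict_eq_empty_iff hF.subset_ground]
  refine forall₂_congr fun e he => ?_
  rw [mem_closure_iff_natRk (hF.subset_ground he), insert_sdiff_singleton, insert_eq_of_mem he,
    eq_comm]

end NatRk

/-! ### The matroid of a rank function -/

section OfRank

variable {β : Type*}

/-- A rank function on the subsets of `E`, with natural numbers as values. -/
structure IsRankFn (E : Set β) (f : Set β → ℕ) : Prop where
  le_ncard : ∀ X ⊆ E, f X ≤ X.ncard
  mono : ∀ X Y, X ⊆ Y → Y ⊆ E → f X ≤ f Y
  submod : ∀ X Y, X ⊆ E → Y ⊆ E → f (X ∩ Y) + f (X ∪ Y) ≤ f X + f Y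

namespace IsRankFn

variable {E : Set β} {f : Set β → ℕ}

theorem union_eq_of_forall_insert_eq (hf : IsRankFn E f) {I J : Set β} (hJ : J.Finite) (hI : I ⊆ E)
    (hJE : J ⊆ E) (h : ∀ e ∈ J, f (insert e I) = f I) : f (I ∪ J) = f I := by
  induction J, hJ using Set.Finite.induction_on with
  | empty => simp
  | @insert e J _ _ ih =>
    have heE : e ∈ E := hJE (mem_insert e J)
    have hJE' : J ⊆ E := (subset_insert e J).trans hJE
    have h₁ := ih hJE' fun x hx => h x (mem_insert_of_mem e hx)
    have h₂ := h e (mem_insert e J)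
    have hIe : insert e I ⊆ E := insert_subset heE hI
    have h₃ := hf.submod _ _ (union_subset hI hJE') hIe
    have h₄ := hf.mono I ((I ∪ J) ∩ insert e I)
      (subset_inter subset_union_left (subset_insert e I)) (inter_subset_right.trans hIe)
    have h₅ : I ∪ J ∪ insert e I = I ∪ insert e J := by
      ext x; simp only [mem_union, mem_insert_iff]; tauto
    rw [h₅] at h₃
    have h₆ := hf.mono I (I ∪ insert e J) subset_union_left (union_subset hI hJE)
    omega

/-- The matroid with rank function `f`. -/
def matroid (hE : E.Finite) (hf : IsRankFn E f) : Matroid β :=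
  (IndepMatroid.ofFinite hE (fun I => I ⊆ E ∧ f I = I.ncard)
    ⟨empty_subset E, by simpa using hf.le_ncard ∅ (empty_subset E)⟩
    (by
      rintro I J ⟨hJE, hJ⟩ hIJ
      have hIE := hIJ.trans hJE
      have h₁ := hf.submod I (J \ I) hIE (sdiff_subset.trans hJE)
      have h₂ := hf.le_ncard (J \ I) (sdiff_subset.trans hJE)
      have h₃ := ncard_sdiff_add_ncard_of_subset hIJ (hE.subset hJE)
      have h₄ := hf.le_ncard I hIE
      rw [union_sdiff_cancel hIJ] at h₁
      exact ⟨hIE, by omega⟩)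
    (by
      rintro I J ⟨hIE, hI⟩ ⟨hJE, hJ⟩ hlt
      by_contra! hcon
      have h₁ : f (I ∪ J) = f I := by
        refine hf.union_eq_of_forall_insert_eq (hE.subset hJE) hIE hJE fun e he => ?_
        by_cases heI : e ∈ I
        · rw [insert_eq_of_mem heI]
        have heE : insert e I ⊆ E := insert_subset (hJE he) hIE
        have h₂ := hcon e he heI heE
        have h₃ := hf.le_ncard _ heE
        have h₄ := hf.mono _ _ (subset_insert e I) heE
        rw [ncard_insert_of_notMem heI (hE.subset hIE)] at h₂ h₃
        omega
      have h₅ := hf.mono _ _ (subset_union_right (s := I)) (union_subset hIE hJE)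
      omega)
    (fun I hI => hI.1)).matroid

theorem matroid_indep_iff (hE : E.Finite) (hf : IsRankFn E f) {I : Set β} :
    (hf.matroid hE).Indep I ↔ I ⊆ E ∧ f I = I.ncard := Iff.rfl

theorem matroid_finite (hE : E.Finite) (hf : IsRankFn E f) : (hf.matroid hE).Finite := ⟨hE⟩

theorem natRk_matroid (hE : E.Finite) (hf : IsRankFn E f) {X : Set β} (hX : X ⊆ E) :
    (hf.matroid hE).natRk X = f X := by
  have := hf.matroid_finite hE
  obtain ⟨I, hI⟩ := (hf.matroid hE).exists_isBasis X hX
  obtain ⟨hIE, hIf⟩ := (hf.matroid_indep_iff hE).1 hI.indep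
  rw [natRk, ← hI.encard_eq_eRk]
  change I.ncard = f X
  rw [← hIf, ← union_eq_self_of_subset_left hI.subset]
  refine (hf.union_eq_of_forall_insert_eq (hE.subset hX) hIE hX fun e he => ?_).symm
  by_cases heI : e ∈ I
  · rw [insert_eq_of_mem heI]
  have heE : insert e I ⊆ E := insert_subset (hX he) hIE
  have h₁ : f (insert e I) ≠ (insert e I).ncard := fun h =>
    heI (hI.mem_of_insert_indep he ((hf.matroid_indep_iff hE).2 ⟨heE, h⟩))
  have h₂ := hf.le_ncard _ heE
  have h₃ := hf.mono _ _ (subset_insert e I) heE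
  rw [ncard_insert_of_notMem heI (hE.subset hIE)] at h₁ h₂
  omega

end IsRankFn

end OfRank

end Matroid

namespace Matroid

open Set

/-! ### The rank function of the free cone -/

section ConeRk

variable {α : Type*} {m : ℕ}

namespace ConeElt

theorem base_injective : Function.Injective (base : α → ConeElt α m) := fun _ _ h => by
  injection h

/-- The element of the original ground set over which an element of the cone lies; the tip lies
over none. -/
def proj : ConeElt α m → Option α
  | base e => some e
  | copy e _ => some e
  | tip => none

end ConeElt

open ConeElt

/-- The support of a set `X` of elements of the cone: the set of all `e` such that `X` contains
`e` or a member of `T_e`. -/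
def coneSupp (X : Set (ConeElt α m)) : Set α := {e | base e ∈ X ∨ ∃ i, ConeElt.copy e i ∈ X}

theorem mem_coneSupp {X : Set (ConeElt α m)} {e : α} :
    e ∈ coneSupp X ↔ base e ∈ X ∨ ∃ i, ConeElt.copy e i ∈ X := Iff.rfl

@[simp]
theorem base_mem_coneSet {S : Set α} {e : α} : (base e : ConeElt α m) ∈ coneSet m S ↔ e ∈ S := by
  simp [coneSet]

@[simp]
theorem copy_mem_coneSet {S : Set α} {e : α} {i : Fin m} :
    ConeElt.copy e i ∈ coneSet m S ↔ e ∈ S := by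
  simp [coneSet]

@[simp]
theorem tip_mem_coneSet {S : Set α} : (tip : ConeElt α m) ∈ coneSet m S := by
  simp [coneSet]

theorem subset_coneSet_iff {X : Set (ConeElt α m)} {S : Set α} :
    X ⊆ coneSet m S ↔ coneSupp X ⊆ S := by
  constructor
  · rintro h e (he | ⟨i, he⟩)
    · simpa using h he
    · simpa using h he
  · rintro h (e | ⟨e, i⟩ | _) hx
    · simpa using h (Or.inl hx)
    · simpa using h (Or.inr ⟨i, hx⟩)
    · simp

theorem coneSupp_mono {X Y : Set (ConeElt α m)} (h : X ⊆ Y) : coneSupp X ⊆ coneSupp Y :=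
  fun _ he => he.imp (fun h' => h h') fun ⟨i, hi⟩ => ⟨i, h hi⟩

theorem coneSupp_union (X Y : Set (ConeElt α m)) :
    coneSupp (X ∪ Y) = coneSupp X ∪ coneSupp Y := by
  ext e
  simp only [mem_coneSupp, mem_union, exists_or]
  tauto

theorem coneSupp_inter_subset (X Y : Set (ConeElt α m)) :
    coneSupp (X ∩ Y) ⊆ coneSupp X ∩ coneSupp Y :=
  subset_inter (coneSupp_mono inter_subset_left) (coneSupp_mono inter_subset_right)

@[simp]
theorem coneSupp_coneSet (S : Set α) : coneSupp (coneSet m S) = S := by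
  ext e
  simp [coneSupp]

@[simp]
theorem coneSupp_image_base (S : Set α) :
    coneSupp (base '' S : Set (ConeElt α m)) = S := by
  ext e
  simp [coneSupp]

theorem preimage_base_subset_coneSupp (X : Set (ConeElt α m)) : base ⁻¹' X ⊆ coneSupp X :=
  fun _ he => Or.inl he

theorem ncard_coneSupp_le {X : Set (ConeElt α m)} (hX : X.Finite) :
    (coneSupp X).ncard ≤ X.ncard := by
  rw [← ncard_image_of_injective (coneSupp X) (Option.some_injective α)]
  refine (ncard_le_ncard ?_ (hX.image proj)).trans (ncard_image_le hX)
  rintro _ ⟨e, he | ⟨i, he⟩, rfl⟩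
  · exact ⟨_, he, rfl⟩
  · exact ⟨_, he, rfl⟩

theorem finite_coneSet {S : Set α} (hS : S.Finite) : (coneSet m S).Finite :=
  ((hS.image _).union (finite_singleton _)).union (hS.biUnion fun _ _ => finite_range _)

variable (M : Matroid α)

/-- The rank function of the free cone: the minimum over the cyclic flats `Z` of the cone of
`r(Z) + |X \ Z|`. The cones of flats give the first term, and the cyclic flats of `M` give the
second one, where all elements outside `M` are counted as coloops. -/
noncomputable def coneRk (X : Set (ConeElt α m)) : ℕ :=
  min (M.natRk (coneSupp X) + 1) (M.natRk (base ⁻¹' X) + (X \ range base).ncard)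

theorem coneRk_def (X : Set (ConeElt α m)) : M.coneRk X =
    min (M.natRk (coneSupp X) + 1) (M.natRk (base ⁻¹' X) + (X \ range base).ncard) := rfl

/-- Elements of the cone outside `M` raise the rank of the support by at most one each. -/
theorem natRk_coneSupp_union_le [M.Finite] {X Y : Set (ConeElt α m)} (hY : Y.Finite) :
    M.natRk (coneSupp (X ∪ Y)) ≤
      M.natRk (coneSupp X ∪ base ⁻¹' Y) + ((Y \ range base) \ X).ncard := by
  have hfin : ((Y \ range base) \ X).Finite := hY.subset (sdiff_subset.trans sdiff_subset)
  have hfin' : (coneSupp ((Y \ range base) \ X)).Finite := by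
    refine Finite.of_finite_image (f := some) ?_ (Option.some_injective α).injOn
    refine (hfin.image proj).subset ?_
    rintro _ ⟨e, he | ⟨i, he⟩, rfl⟩
    · exact ⟨_, he, rfl⟩
    · exact ⟨_, he, rfl⟩
  have hsub : coneSupp (X ∪ Y) ⊆
      (coneSupp X ∪ base ⁻¹' Y) ∪ coneSupp ((Y \ range base) \ X) := by
    intro e he
    simp only [mem_coneSupp, mem_union, mem_sdiff, mem_range, mem_preimage, reduceCtorEq,
      exists_false, not_false_eq_true, and_true] at he ⊢
    by_cases h : ∃ i, ConeElt.copy e i ∈ X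
    · exact Or.inl (Or.inl (Or.inr h))
    · rcases he with (he | he) | ⟨i, he | he⟩
      · exact Or.inl (Or.inl (Or.inl he))
      · exact Or.inl (Or.inr he)
      · exact absurd ⟨i, he⟩ h
      · exact Or.inr (Or.inr ⟨i, he, fun h' => h ⟨i, h'⟩⟩)
  have h₁ := M.natRk_mono hsub
  have h₂ := M.natRk_union_le_add_ncard (coneSupp X ∪ base ⁻¹' Y) hfin'
  have h₃ := ncard_coneSupp_le hfin
  omega

theorem natRk_coneSupp_le [M.Finite] {X : Set (ConeElt α m)} (hX : X.Finite) :
    M.natRk (coneSupp X) ≤ M.natRk (base ⁻¹' X) + (X \ range base).ncard := by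
  have h := M.natRk_coneSupp_union_le (X := ∅) hX
  have h₀ : coneSupp (∅ : Set (ConeElt α m)) = ∅ := by ext; simp [coneSupp]
  simpa [h₀] using h

theorem coneRk_inter_add_coneRk_union_le [M.Finite] {X Y : Set (ConeElt α m)} (hX : X.Finite)
    (hY : Y.Finite) :
    M.coneRk (X ∩ Y) + M.coneRk (X ∪ Y) ≤ M.coneRk X + M.coneRk Y := by
  -- The mixed case, where the two terms of the minimum are attained at different sets.
  have mixed : ∀ X Y : Set (ConeElt α m), X.Finite → Y.Finite →
      M.coneRk (X ∩ Y) + M.coneRk (X ∪ Y) ≤ (M.natRk (coneSupp X) + 1) +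
        (M.natRk (base ⁻¹' Y) + (Y \ range base).ncard) := by
    intro X Y hX hY
    have h₁ := M.natRk_coneSupp_union_le (X := X) hY
    have h₂ := M.natRk_inter_add_natRk_union_le (coneSupp X) (base ⁻¹' Y)
    have h₃ : M.natRk (base ⁻¹' (X ∩ Y)) ≤ M.natRk (coneSupp X ∩ base ⁻¹' Y) :=
      M.natRk_mono (inter_subset_inter_left _ (preimage_base_subset_coneSupp X))
    have h₄ : ((X ∩ Y) \ range base).ncard + ((Y \ range base) \ X).ncard
        = (Y \ range base).ncard := by
      have hfin : (Y \ range (base : α → ConeElt α m)).Finite := hY.subset sdiff_subset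
      rw [← ncard_inter_add_ncard_sdiff_eq_ncard (Y \ range base) X hfin]
      congr 2
      ext x
      simp only [mem_sdiff, mem_inter_iff]
      tauto
    simp only [coneRk]
    omega
  have first : M.coneRk (X ∩ Y) + M.coneRk (X ∪ Y) ≤
      (M.natRk (coneSupp X) + 1) + (M.natRk (coneSupp Y) + 1) := by
    have h₁ := M.natRk_inter_add_natRk_union_le (coneSupp X) (coneSupp Y)
    have h₂ := M.natRk_mono (coneSupp_inter_subset X Y)
    rw [← coneSupp_union] at h₁
    simp only [coneRk]
    omega
  have second : M.coneRk (X ∩ Y) + M.coneRk (X ∪ Y) ≤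
      (M.natRk (base ⁻¹' X) + (X \ range base).ncard) +
        (M.natRk (base ⁻¹' Y) + (Y \ range base).ncard) := by
    have h₁ := M.natRk_inter_add_natRk_union_le (base ⁻¹' X) (base ⁻¹' Y)
    have h₂ := ncard_union_add_ncard_inter (X \ range base) (Y \ range base)
      (hX.subset sdiff_subset) (hY.subset sdiff_subset)
    have h₃ : X \ range base ∩ (Y \ range base) = (X ∩ Y) \ range base := by
      ext x
      simp only [mem_sdiff, mem_inter_iff]
      tauto
    rw [← union_sdiff_distrib, h₃] at h₂
    rw [← preimage_inter, ← preimage_union] at h₁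
    simp only [coneRk]
    omega
  have hXY := mixed X Y hX hY
  have hYX := mixed Y X hY hX
  rw [inter_comm, union_comm] at hYX
  have hdX := M.coneRk_def X
  have hdY := M.coneRk_def Y
  omega

theorem isRankFn_coneRk [M.Finite] : IsRankFn (coneSet m M.E) M.coneRk where
  le_ncard X hX := by
    have hXfin := (finite_coneSet M.ground_finite).subset hX
    have h₁ : (base ⁻¹' X : Set α).ncard = (X ∩ range base).ncard := by
      rw [← image_preimage_eq_inter_range, ncard_image_of_injective _ base_injective]
    have h₂ := M.natRk_le_ncard (hXfin.preimage base_injective.injOn)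
    have h₃ := ncard_inter_add_ncard_sdiff_eq_ncard X (range base) hXfin
    simp only [coneRk]
    omega
  mono X Y hXY hY := by
    have hYfin := (finite_coneSet M.ground_finite).subset hY
    have h₁ := M.natRk_mono (coneSupp_mono hXY)
    have h₂ := M.natRk_mono (preimage_mono (f := base) hXY)
    have h₃ := ncard_le_ncard (sdiff_subset_sdiff_left hXY) (hYfin.subset
      (sdiff_subset (t := range base)))
    simp only [coneRk]
    omega
  submod X Y hX hY := M.coneRk_inter_add_coneRk_union_le
    ((finite_coneSet M.ground_finite).subset hX) ((finite_coneSet M.ground_finite).subset hY)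

end ConeRk

/-! ### The free cone -/

section FreeCone

open ConeElt

variable {α : Type*} (m : ℕ) (M : Matroid α)

/-- The free `m`-cone of `M`, given by its rank function. -/
noncomputable def freeCone [M.Finite] : Matroid (ConeElt α m) :=
  (isRankFn_coneRk (m := m) M).matroid (finite_coneSet M.ground_finite)

theorem freeCone_E [M.Finite] : (freeCone m M).E = coneSet m M.E := rfl

instance [M.Finite] : (freeCone m M).Finite := ⟨finite_coneSet M.ground_finite⟩

variable {m}

theorem natRk_freeCone [M.Finite] {X : Set (ConeElt α m)} (hX : X ⊆ coneSet m M.E) :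
    (freeCone m M).natRk X = M.coneRk X :=
  (isRankFn_coneRk (m := m) M).natRk_matroid _ hX

theorem coneRk_image_base (F : Set α) : M.coneRk (base '' F : Set (ConeElt α m)) = M.natRk F := by
  have h₁ : (base '' F : Set (ConeElt α m)) \ range base = ∅ :=
    sdiff_eq_empty.2 (image_subset_range _ _)
  simp [coneRk, h₁, preimage_image_eq F base_injective]

theorem coneRk_insert_image_base [M.Finite] {F : Set α} {x : ConeElt α m} (hx : x ∉ range base) :
    M.coneRk (insert x (base '' F)) = M.natRk F + 1 := by
  have h₁ : insert x (base '' F) \ range base = {x} := by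
    rw [insert_sdiff_of_notMem _ hx, sdiff_eq_empty.2 (image_subset_range _ _), insert_empty_eq]
  have h₂ : base ⁻¹' (insert x (base '' F)) = F := by
    rw [← singleton_union, preimage_union, preimage_singleton_eq_empty.2 hx, empty_union,
      preimage_image_eq F base_injective]
  have h₃ : M.natRk F ≤ M.natRk (coneSupp (insert x (base '' F))) := by
    refine M.natRk_mono ?_
    conv_lhs => rw [← h₂]
    exact preimage_base_subset_coneSupp _
  rw [coneRk, h₁, h₂, ncard_singleton]
  omega

theorem two_le_ncard_coneSet_diff (hm : 1 ≤ m) {F : Set α} (hF : F.Finite) (hne : F.Nonempty) :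
    2 ≤ (coneSet m F \ range base).ncard := by
  obtain ⟨e, he⟩ := hne
  refine (one_lt_ncard ((finite_coneSet hF).subset sdiff_subset)).2
    ⟨tip, ⟨by simp, by simp⟩, ConeElt.copy e ⟨0, hm⟩, ⟨by simpa, by simp⟩, by simp⟩

theorem coneRk_coneSet {F : Set α} (hF : F.Finite) :
    M.coneRk (coneSet m F) = M.natRk F + 1 := by
  have h : 0 < (coneSet m F \ range base).ncard :=
    (ncard_pos ((finite_coneSet hF).subset sdiff_subset)).2 ⟨tip, by simp, by simp⟩
  have h₁ : base ⁻¹' (coneSet m F) = F := by ext; simp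
  rw [coneRk, coneSupp_coneSet, h₁]
  omega

theorem isFlat_coneSet [M.Finite] (hm : 1 ≤ m) {F : Set α} (hF : M.IsFlat F) (hne : F.Nonempty) :
    (freeCone m M).IsFlat (coneSet m F) := by
  obtain ⟨hFE, hF'⟩ := isFlat_iff_natRk.1 hF
  have hfin := M.ground_finite.subset hFE
  have hE : coneSet m F ⊆ coneSet m M.E := subset_coneSet_iff.2 (by simpa)
  refine isFlat_iff_natRk.2 ⟨hE, fun x hx => ?_⟩
  rw [freeCone_E] at hx
  rw [natRk_freeCone M hE, natRk_freeCone M (insert_subset hx.1 hE), coneRk_coneSet M hfin]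
  have hk := two_le_ncard_coneSet_diff hm hfin hne
  have h₀ : base ⁻¹' (coneSet m F) = F := by ext; simp
  have h₁ : M.natRk F ≤ M.natRk (base ⁻¹' (insert x (coneSet m F))) :=
    M.natRk_mono (h₀.symm.subset.trans (preimage_mono (subset_insert _ _)))
  have h₂ := ncard_le_ncard
    (sdiff_subset_sdiff_left (t := range base) (subset_insert x (coneSet m F)))
    (((finite_coneSet hfin).insert x).subset sdiff_subset)
  obtain ⟨e, heE, heF, hsupp⟩ : ∃ e, e ∈ M.E ∧ e ∉ F ∧
      coneSupp (insert x (coneSet m F)) = insert e F := by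
    rcases x with e | ⟨e, i⟩ | _
    · refine ⟨e, by simpa using hx.1, by simpa using hx.2, ?_⟩
      ext a
      simp only [mem_coneSupp, mem_insert_iff, base.injEq, base_mem_coneSet, reduceCtorEq, false_or,
        copy_mem_coneSet]
      exact ⟨fun h => h.elim id fun ⟨_, h⟩ => Or.inr h, Or.inl⟩
    · refine ⟨e, by simpa using hx.1, by simpa using hx.2, ?_⟩
      ext a
      simp only [mem_coneSupp, mem_insert_iff, reduceCtorEq, base_mem_coneSet, false_or,
        ConeElt.copy.injEq, copy_mem_coneSet]
      constructor
      · rintro (h | ⟨j, ⟨h, -⟩ | h⟩)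
        exacts [Or.inr h, Or.inl h, Or.inr h]
      · rintro (rfl | h)
        exacts [Or.inr ⟨i, Or.inl ⟨rfl, rfl⟩⟩, Or.inl h]
    · exact absurd tip_mem_coneSet hx.2
  have h₃ := hF' e ⟨heE, heF⟩
  have h₄ := M.natRk_mono (subset_insert e F)
  rw [coneRk, hsupp]
  omega

theorem coneRk_coneSet_diff_singleton [M.Finite] (hm : 1 ≤ m) {F : Set α} (hFE : F ⊆ M.E)
    (hne : F.Nonempty) {x : ConeElt α m} (hx : x ∈ coneSet m F) :
    M.coneRk (coneSet m F \ {x}) = M.coneRk (coneSet m F) := by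
  have hfin := M.ground_finite.subset hFE
  have hk := two_le_ncard_coneSet_diff hm hfin hne
  have hkfin : (coneSet m F \ range base).Finite := (finite_coneSet hfin).subset sdiff_subset
  rw [coneRk_coneSet M hfin]
  have hsupp : coneSupp (coneSet m F \ {x}) = F := by
    ext a
    rcases x with e | ⟨e, i⟩ | _
    · simp only [mem_coneSupp, mem_sdiff, base_mem_coneSet, mem_singleton_iff, base.injEq,
        copy_mem_coneSet, reduceCtorEq, not_false_eq_true, and_true]
      exact ⟨fun h => h.elim And.left fun ⟨_, h⟩ => h, fun h => Or.inr ⟨⟨0, hm⟩, h⟩⟩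
    · simp only [mem_coneSupp, mem_sdiff, base_mem_coneSet, mem_singleton_iff, copy_mem_coneSet,
        reduceCtorEq, not_false_eq_true, and_true]
      exact ⟨fun h => h.elim id fun ⟨_, h⟩ => h.1, Or.inl⟩
    · simp only [mem_coneSupp, mem_sdiff, base_mem_coneSet, mem_singleton_iff, copy_mem_coneSet,
        reduceCtorEq, not_false_eq_true, and_true]
      exact ⟨fun h => h.elim id fun ⟨_, h⟩ => h, Or.inl⟩
  rw [coneRk, hsupp]
  have h₀ : base ⁻¹' (coneSet m F) = F := by ext; simp
  by_cases hxb : x ∈ range base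
  · obtain ⟨e, rfl⟩ := hxb
    have h₁ : (coneSet m F \ {base e}) \ range base = coneSet m F \ range base := by
      rw [Set.sdiff_sdiff, union_eq_self_of_subset_left (by simp)]
    have h₂ : base ⁻¹' (coneSet m F \ {base e}) = F \ {e} := by ext; simp
    have h₃ := M.natRk_insert_le e (F \ {e})
    have h₄ := M.natRk_mono (show F ⊆ insert e (F \ {e}) by simp)
    rw [h₁, h₂]
    omega
  · have h₁ : (coneSet m F \ {x}) \ range base = (coneSet m F \ range base) \ {x} := by
      rw [Set.sdiff_sdiff_comm]
    have h₂ : base ⁻¹' (coneSet m F \ {x}) = F := by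
      rw [preimage_sdiff, preimage_singleton_eq_empty.2 hxb, sdiff_empty, h₀]
    rw [h₁, h₂, ncard_sdiff_singleton_of_mem (show x ∈ coneSet m F \ range base from ⟨hx, hxb⟩)]
    omega

theorem isCyclicFlat_freeCone_image_base [M.Finite] {F : Set α} :
    (freeCone m M).IsCyclicFlat (base '' F) ↔ M.IsCyclicFlat F := by
  have hsub : (base '' F : Set (ConeElt α m)) ⊆ coneSet m M.E ↔ F ⊆ M.E := by
    rw [subset_coneSet_iff, coneSupp_image_base]
  have hdiff : ∀ e, (base '' F : Set (ConeElt α m)) \ {base e} = base '' (F \ {e}) := fun e => by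
    rw [image_sdiff base_injective, image_singleton]
  rw [isCyclicFlat_iff_natRk, isCyclicFlat_iff_natRk, isFlat_iff_natRk, isFlat_iff_natRk,
    freeCone_E, hsub, and_assoc, and_assoc]
  refine and_congr_right fun hF => ?_
  have hFE := hsub.2 hF
  have hrk : ∀ G ⊆ M.E, (freeCone m M).natRk (base '' G) = M.natRk G := fun G hG => by
    rw [natRk_freeCone M (subset_coneSet_iff.2 (by simpa)), coneRk_image_base]
  refine and_congr ⟨fun h e he => ?_, fun h x hx => ?_⟩ ?_
  · have := h (base e) ⟨by simpa using he.1, by simpa using he.2⟩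
    rwa [← image_insert_eq, hrk _ (insert_subset he.1 hF), hrk F hF] at this
  · by_cases hxb : x ∈ range base
    · obtain ⟨e, rfl⟩ := hxb
      have he : e ∈ M.E \ F := by simpa using hx
      rw [← image_insert_eq, hrk _ (insert_subset he.1 hF), hrk F hF]
      exact h e he
    · rw [natRk_freeCone M (insert_subset hx.1 hFE), coneRk_insert_image_base M hxb, hrk F hF]
      omega
  · rw [forall_mem_image]
    refine forall₂_congr fun e _ => ?_
    rw [hdiff, hrk _ (sdiff_subset.trans hF), hrk F hF]

/-- A cyclic flat with an element outside `M` is the cone of a nonempty flat: removing such an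
element lowers the second term of the rank function, so that the first one is attained, and the
first one depends on the support only. -/
theorem IsCyclicFlat.exists_eq_coneSet [M.Finite] {Z : Set (ConeElt α m)}
    (hZ : (freeCone m M).IsCyclicFlat Z)
    (hb : ¬ Z ⊆ range base) : ∃ F, M.IsFlat F ∧ F.Nonempty ∧ Z = coneSet m F := by
  obtain ⟨hflat, hcyc⟩ := isCyclicFlat_iff_natRk.1 hZ
  obtain ⟨hZE, hins⟩ := isFlat_iff_natRk.1 hflat
  rw [freeCone_E] at hZE hins
  have hZfin := (finite_coneSet M.ground_finite).subset hZE
  have hsupp : coneSupp Z ⊆ M.E := subset_coneSet_iff.1 hZE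
  obtain ⟨x, hxZ, hxb⟩ := not_subset.1 hb
  have hrk : M.coneRk Z = M.natRk (coneSupp Z) + 1 := by
    have h₁ := hcyc x hxZ
    rw [natRk_freeCone M hZE, natRk_freeCone M (sdiff_subset.trans hZE)] at h₁
    have h₂ : (Z \ {x}) \ range base = (Z \ range base) \ {x} := by
      rw [Set.sdiff_sdiff_comm]
    have h₃ : base ⁻¹' (Z \ {x}) = base ⁻¹' Z := by
      rw [preimage_sdiff, preimage_singleton_eq_empty.2 hxb, sdiff_empty]
    have h₄ : M.coneRk (Z \ {x}) ≤ M.natRk (base ⁻¹' Z) + ((Z \ range base).ncard - 1) := by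
      rw [coneRk, h₂, h₃, ncard_sdiff_singleton_of_mem (show x ∈ Z \ range base from ⟨hxZ, hxb⟩)]
      exact min_le_right _ _
    have h₅ : 0 < (Z \ range base).ncard :=
      (ncard_pos (hZfin.subset sdiff_subset)).2 ⟨x, hxZ, hxb⟩
    have h₆ := M.coneRk_def Z
    omega
  -- Every element of the ground set over the closure of the support lies in `Z`.
  have hmem : ∀ y ∈ coneSet m M.E,
      M.natRk (coneSupp (insert y Z)) = M.natRk (coneSupp Z) → y ∈ Z := by
    intro y hy h
    by_contra hyZ
    have h₁ := hins y ⟨hy, hyZ⟩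
    rw [natRk_freeCone M hZE, natRk_freeCone M (insert_subset hy hZE)] at h₁
    have h₂ := (isRankFn_coneRk (m := m) M).mono _ _ (subset_insert y Z) (insert_subset hy hZE)
    have h₃ : M.coneRk (insert y Z) ≤ M.natRk (coneSupp (insert y Z)) + 1 := min_le_left _ _
    omega
  have hcl : coneSet m (M.closure (coneSupp Z)) ⊆ Z := by
    intro y hy
    have hyE : y ∈ coneSet m M.E := by
      refine subset_coneSet_iff.2 ?_ hy
      rw [coneSupp_coneSet]
      exact M.closure_subset_ground _
    refine hmem y hyE (le_antisymm ?_ (M.natRk_mono (coneSupp_mono (subset_insert _ _))))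
    rw [← M.natRk_closure (coneSupp Z)]
    refine M.natRk_mono (subset_coneSet_iff.1 (insert_subset hy (subset_coneSet_iff.2 ?_)))
    exact M.subset_closure _ hsupp
  have hZeq : Z = coneSet m (M.closure (coneSupp Z)) :=
    (subset_coneSet_iff.2 (M.subset_closure _ hsupp)).antisymm hcl
  refine ⟨_, M.isFlat_closure _, ?_, hZeq⟩
  -- The set consisting of the tip alone is independent, hence not cyclic.
  rw [nonempty_iff_ne_empty]
  intro hempty
  have h₁ : Z = {tip} := by
    rw [hZeq, hempty]
    simp [coneSet]
  subst h₁
  have h₂ := hcyc tip rfl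
  have h₃ : coneSupp ({tip} : Set (ConeElt α m)) = ∅ := by ext; simp [coneSupp]
  rw [natRk_freeCone M hZE, hrk, Set.sdiff_self, natRk_empty, h₃] at h₂
  omega

theorem isFreeCone_freeCone [M.Finite] (hm : 1 ≤ m) : IsFreeCone m M (freeCone m M) where
  ground_eq := rfl
  isCyclicFlat_iff Z := by
    constructor
    · intro hZ
      by_cases hb : Z ⊆ range base
      · obtain ⟨F, rfl⟩ := subset_range_iff_exists_image_eq.1 hb
        exact Or.inl ⟨F, (isCyclicFlat_freeCone_image_base M).1 hZ, rfl⟩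
      · exact Or.inr (IsCyclicFlat.exists_eq_coneSet M hZ hb)
    · rintro (⟨F, hF, rfl⟩ | ⟨F, hF, hne, rfl⟩)
      · exact (isCyclicFlat_freeCone_image_base M).2 hF
      · have hE : coneSet m F ⊆ coneSet m M.E := subset_coneSet_iff.2 (by
          simpa using hF.subset_ground)
        refine isCyclicFlat_iff_natRk.2 ⟨isFlat_coneSet M hm hF hne, fun x hx => ?_⟩
        rw [natRk_freeCone M hE, natRk_freeCone M (sdiff_subset.trans hE),
          coneRk_coneSet_diff_singleton M hm hF.subset_ground hne hx]
  eRk_base F hF := by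
    have hE : (base '' F : Set (ConeElt α m)) ⊆ coneSet m M.E := subset_coneSet_iff.2 (by
      simpa using hF.1.subset_ground)
    rw [← coe_natRk, ← coe_natRk, natRk_freeCone M hE, coneRk_image_base]
  eRk_cone F hF hne := by
    have hE : coneSet m F ⊆ coneSet m M.E := subset_coneSet_iff.2 (by
      simpa using hF.subset_ground)
    rw [← coe_natRk, ← coe_natRk, natRk_freeCone M hE,
      coneRk_coneSet M (M.ground_finite.subset hF.subset_ground)]
    push_cast
    rfl

theorem IsFreeCone.eq_freeCone [M.Finite] (hm : 1 ≤ m) {Q : Matroid (ConeElt α m)}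
    (hQ : IsFreeCone m M Q) : Q = freeCone m M := by
  have hQ' := isFreeCone_freeCone M hm
  have := hQ.finite
  refine ext_isCyclicFlat hQ.ground_eq
    (fun Z => (hQ.isCyclicFlat_iff Z).trans (hQ'.isCyclicFlat_iff Z).symm) fun Z hZ => ?_
  rcases (hQ.isCyclicFlat_iff Z).1 hZ with ⟨F, hF, rfl⟩ | ⟨F, hF, hne, rfl⟩
  · rw [hQ.eRk_base F hF, hQ'.eRk_base F hF]
  · rw [hQ.eRk_cone F hF hne, hQ'.eRk_cone F hF hne]

end FreeCone

end Matroid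

namespace Matroid

open Set

/-! ### Subsets of the free cone with a given support -/

section Fiber

open ConeElt

variable {α : Type*} {m : ℕ}

/-- The element over `e` with a given index: `e` itself for `none`, and a member of `T_e` for
`some i`. -/
def coneOver (e : α) : Option (Fin m) → ConeElt α m
  | none => base e
  | some i => ConeElt.copy e i

/-- The elements of the cone other than the tip are pairs of an element `e` and an index. -/
def coneEquiv (α : Type*) (m : ℕ) : Option (α × Option (Fin m)) ≃ ConeElt α m where
  toFun
    | none => tip
    | some (e, o) => coneOver e o
  invFun
    | base e => some (e, none)
    | ConeElt.copy e i => some (e, some i)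
    | tip => none
  left_inv := by rintro (_ | ⟨e, _ | i⟩) <;> rfl
  right_inv := by rintro (e | ⟨e, i⟩ | _) <;> rfl

theorem coneOver_injective2 :
    Function.Injective2 (coneOver : α → Option (Fin m) → ConeElt α m) := by
  rintro a b (_ | i) (_ | j) h <;> simp_all [coneOver]

theorem tip_ne_coneOver (e : α) (o : Option (Fin m)) : tip ≠ coneOver e o := by
  cases o <;> simp [coneOver]

theorem eq_tip_or_coneOver (x : ConeElt α m) : x = tip ∨ ∃ e o, x = coneOver e o := by
  rcases x with e | ⟨e, i⟩ | _
  exacts [Or.inr ⟨e, none, rfl⟩, Or.inr ⟨e, some i, rfl⟩, Or.inl rfl]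

theorem mem_coneSupp_iff_coneOver {X : Set (ConeElt α m)} {e : α} :
    e ∈ coneSupp X ↔ ∃ o, coneOver e o ∈ X := by
  rw [Option.exists]
  rfl

/-- The cone of a finite set as a finite set. -/
def coneFinset (m : ℕ) (S : Finset α) : Finset (ConeElt α m) :=
  (Finset.insertNone (S ×ˢ (Finset.univ : Finset (Option (Fin m))))).map (coneEquiv α m).toEmbedding

theorem coe_coneFinset (S : Finset α) :
    (coneFinset m S : Set (ConeElt α m)) = coneSet m (S : Set α) := by
  ext x
  rw [coneFinset, Finset.coe_map, mem_image]
  simp only [Finset.mem_coe, Finset.mem_insertNone, Finset.mem_product, Finset.mem_univ, and_true,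
    Option.mem_def, Equiv.coe_toEmbedding, (coneEquiv α m).exists_congr_left,
    Equiv.apply_symm_apply, exists_eq_right]
  rcases x with e | ⟨e, i⟩ | _ <;> simp [coneEquiv]

theorem card_coneFinset (S : Finset α) : (coneFinset m S).card = (m + 1) * S.card + 1 := by
  simp [coneFinset, mul_comm]

open scoped Classical in
/-- The support of a finite set of elements of the cone as a finite set. -/
noncomputable def coneSuppFinset (X : Finset (ConeElt α m)) : Finset α :=
  (X.image proj).eraseNone

theorem coe_coneSuppFinset (X : Finset (ConeElt α m)) :
    (coneSuppFinset X : Set α) = coneSupp (X : Set (ConeElt α m)) := by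
  ext e
  simp only [coneSuppFinset, Finset.mem_coe, Finset.mem_eraseNone, Finset.mem_image, mem_coneSupp]
  constructor
  · rintro ⟨e | ⟨e, i⟩ | _, hx, h⟩ <;> simp only [proj, Option.some.injEq, reduceCtorEq] at h
    · exact Or.inl (h ▸ hx)
    · exact Or.inr ⟨i, h ▸ hx⟩
  · rintro (h | ⟨i, h⟩)
    exacts [⟨_, h, rfl⟩, ⟨_, h, rfl⟩]

theorem subset_coneFinset_iff {X : Finset (ConeElt α m)} {S : Finset α} :
    X ⊆ coneFinset m S ↔ coneSuppFinset X ⊆ S := by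
  rw [← Finset.coe_subset, coe_coneFinset, subset_coneSet_iff, ← coe_coneSuppFinset,
    Finset.coe_subset]

open scoped Classical in
/-- The finite sets of elements of the cone with support `S`. -/
noncomputable def coneFiber (m : ℕ) (S : Finset α) : Finset (Finset (ConeElt α m)) :=
  {X ∈ (coneFinset m S).powerset | coneSuppFinset X = S}

theorem mem_coneFiber {S : Finset α} {X : Finset (ConeElt α m)} :
    X ∈ coneFiber m S ↔ coneSuppFinset X = S := by
  classical
  rw [coneFiber, Finset.mem_filter, Finset.mem_powerset, subset_coneFinset_iff]
  exact ⟨And.right, fun h => ⟨h.subset, h⟩⟩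

theorem sum_powerset_coneFinset {R : Type*} [AddCommMonoid R] (S : Finset α)
    (f : Finset (ConeElt α m) → R) :
    ∑ X ∈ (coneFinset m S).powerset, f X = ∑ S' ∈ S.powerset, ∑ X ∈ coneFiber m S', f X := by
  classical
  rw [← Finset.sum_fiberwise_of_maps_to (g := coneSuppFinset) (t := S.powerset)
    fun X hX => Finset.mem_powerset.2 (subset_coneFinset_iff.1 (Finset.mem_powerset.1 hX))]
  refine Finset.sum_congr rfl fun S' hS' => Finset.sum_congr ?_ fun _ _ => rfl
  ext X
  rw [Finset.mem_filter, mem_coneFiber, Finset.mem_powerset, subset_coneFinset_iff]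
  exact ⟨And.right, fun h => ⟨h ▸ Finset.mem_powerset.1 hS', h⟩⟩

/-- The generating function for the sizes of the sets with support `S`. Summed over all subsets of
`S`, both sides give `(1 + z) ^ |q(S)|`. -/
theorem sum_coneFiber_pow_card {R : Type*} [CommRing R] (z : R) (S : Finset α) :
    ∑ X ∈ coneFiber m S, z ^ X.card = (1 + z) * ((1 + z) ^ (m + 1) - 1) ^ S.card := by
  classical
  induction S using Finset.strongInduction with
  | H S ih =>
    have h₁ : ∑ S' ∈ S.powerset, ∑ X ∈ coneFiber m S', z ^ X.card =
        ∑ S' ∈ S.powerset, (1 + z) * ((1 + z) ^ (m + 1) - 1) ^ S'.card := by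
      have h₂ := Finset.sum_pow_mul_eq_add_pow z 1 (coneFinset m S)
      have h₃ := Finset.sum_pow_mul_eq_add_pow ((1 + z) ^ (m + 1) - 1) 1 S
      simp only [one_pow, mul_one] at h₂ h₃
      rw [← sum_powerset_coneFinset, ← Finset.mul_sum, h₂, h₃, card_coneFinset,
        add_comm z 1, sub_add_cancel, pow_succ', ← pow_mul]
    rw [← Finset.add_sum_erase _ _ (Finset.mem_powerset_self S),
      ← Finset.add_sum_erase _ _ (Finset.mem_powerset_self S)] at h₁
    rw [Finset.sum_congr rfl fun S' hS' => ih S' ?_] at h₁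
    · exact add_right_cancel h₁
    · rw [Finset.mem_erase, Finset.mem_powerset] at hS'
      exact lt_of_le_of_ne hS'.2 hS'.1

end Fiber

/-! ### Subsets of the free cone with the same rank as their support -/

section Section

open ConeElt

variable {α : Type*} {m : ℕ}

open scoped Classical in
/-- The set that contains one element over each `e ∈ S`, the one with index `p e`. -/
noncomputable def coneSection (S : Finset α) (p : ∀ e ∈ S, Option (Fin m)) :
    Finset (ConeElt α m) :=
  S.attach.image fun e => coneOver e.1 (p e.1 e.2)

theorem coneOver_mem_coneSection {S : Finset α} {p : ∀ e ∈ S, Option (Fin m)} {e : α}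
    {o : Option (Fin m)} : coneOver e o ∈ coneSection S p ↔ ∃ h : e ∈ S, p e h = o := by
  simp only [coneSection, Finset.mem_image, Finset.mem_attach, true_and, Subtype.exists]
  constructor
  · rintro ⟨a, ha, h⟩
    obtain ⟨rfl, rfl⟩ := coneOver_injective2 h
    exact ⟨ha, rfl⟩
  · rintro ⟨h, rfl⟩
    exact ⟨e, h, rfl⟩

theorem tip_notMem_coneSection {S : Finset α} {p : ∀ e ∈ S, Option (Fin m)} :
    tip ∉ coneSection S p := by
  simp [coneSection, (tip_ne_coneOver _ _).symm]

theorem card_coneSection (S : Finset α) (p : ∀ e ∈ S, Option (Fin m)) :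
    (coneSection S p).card = S.card := by
  classical
  rw [coneSection, Finset.card_image_of_injective, Finset.card_attach]
  exact fun a b h => Subtype.ext (coneOver_injective2 h).1

theorem coneSuppFinset_coneSection (S : Finset α) (p : ∀ e ∈ S, Option (Fin m)) :
    coneSuppFinset (coneSection S p) = S := by
  rw [← Finset.coe_inj, coe_coneSuppFinset]
  ext e
  simp only [mem_coneSupp_iff_coneOver, Finset.mem_coe, coneOver_mem_coneSection]
  exact ⟨fun ⟨_, h, _⟩ => h, fun h => ⟨_, h, rfl⟩⟩

variable (M : Matroid α) [M.Finite]

theorem natRk_coneSupp_le_coneRk {X : Set (ConeElt α m)} (hX : X.Finite) :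
    M.natRk (coneSupp X) ≤ M.coneRk X :=
  le_min (Nat.le_succ _) (M.natRk_coneSupp_le hX)

variable {M}

/-- A set has the rank of its support if it contains exactly one element over each element of the
support, and elements outside `M` only over coloops. -/
theorem coneRk_coneSection {S : Finset α} (hS : (S : Set α) ⊆ M.E)
    {p : ∀ e ∈ S, Option (Fin m)}
    (hp : ∀ e he, e ∉ (M ↾ (S : Set α)).coloops → p e he = none) :
    M.coneRk (coneSection S p : Set (ConeElt α m)) = M.natRk (S : Set α) := by
  set X := (coneSection S p : Set (ConeElt α m)) with hX
  have hXfin : X.Finite := Finset.finite_toSet _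
  have hbase : ∀ e, base e ∈ X ↔ ∃ h : e ∈ S, p e h = none := fun e =>
    coneOver_mem_coneSection (o := none)
  set K : Set α := S \ base ⁻¹' X with hK
  have hKsub : K ⊆ (M ↾ (S : Set α)).coloops := fun e he =>
    by_contra fun h => he.2 ((hbase e).2 ⟨he.1, hp e he.1 h⟩)
  have hBS : base ⁻¹' X ⊆ (S : Set α) := fun e he => ((hbase e).1 he).1
  have hSK : (S : Set α) \ K = base ⁻¹' X := by
    rw [hK, Set.sdiff_sdiff_cancel_left hBS]
  have h₁ := natRk_diff_add_ncard_of_subset_coloops hS hKsub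
  have h₂ : (base ⁻¹' X : Set α).ncard = (X ∩ range base).ncard := by
    rw [← image_preimage_eq_inter_range, ncard_image_of_injective _ base_injective]
  have h₃ := ncard_inter_add_ncard_sdiff_eq_ncard X (range base) hXfin
  have h₄ := ncard_sdiff_add_ncard_of_subset hBS S.finite_toSet
  have h₅ : X.ncard = S.card := by rw [hX, ncard_coe_finset, card_coneSection]
  rw [ncard_coe_finset, ← hK] at h₄
  have h₆ : coneSupp X = S := by rw [hX, ← coe_coneSuppFinset, coneSuppFinset_coneSection]
  rw [hSK] at h₁
  rw [coneRk, h₆]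
  omega

/-- Conversely, removing an element outside `M` from a set of the same rank as its support lowers
the rank of the support. -/
theorem natRk_coneSupp_diff_singleton_lt {X : Set (ConeElt α m)} (hX : X.Finite)
    (h : M.coneRk X = M.natRk (coneSupp X)) {x : ConeElt α m} (hx : x ∈ X)
    (hxb : x ∉ range base) : M.natRk (coneSupp (X \ {x})) < M.natRk (coneSupp X) := by
  have h₁ := M.natRk_coneSupp_le (hX.subset (sdiff_subset (t := {x})))
  have h₂ : (X \ {x}) \ range base = (X \ range base) \ {x} := Set.sdiff_sdiff_comm
  have h₃ : base ⁻¹' (X \ {x}) = base ⁻¹' X := by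
    rw [preimage_sdiff, preimage_singleton_eq_empty.2 hxb, sdiff_empty]
  have h₅ : 0 < (X \ range base).ncard := (ncard_pos (hX.subset sdiff_subset)).2 ⟨x, hx, hxb⟩
  rw [h₂, h₃, ncard_sdiff_singleton_of_mem (show x ∈ X \ range base from ⟨hx, hxb⟩)] at h₁
  rw [coneRk] at h
  omega

theorem exists_eq_coneSection {S : Finset α} (hS : (S : Set α) ⊆ M.E)
    {X : Finset (ConeElt α m)} (hXS : coneSuppFinset X = S)
    (hrk : M.coneRk (X : Set (ConeElt α m)) = M.natRk (S : Set α)) :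
    ∃ p : ∀ e ∈ S, Option (Fin m), (∀ e he, e ∉ (M ↾ (S : Set α)).coloops → p e he = none) ∧
      coneSection S p = X := by
  have hsupp : coneSupp (X : Set (ConeElt α m)) = S := by rw [← coe_coneSuppFinset, hXS]
  have hlt : ∀ x ∈ X, x ∉ range base →
      M.natRk (coneSupp ((X : Set (ConeElt α m)) \ {x})) < M.natRk (S : Set α) := by
    intro x hx hxb
    rw [← hsupp] at hrk ⊢
    exact natRk_coneSupp_diff_singleton_lt X.finite_toSet hrk hx hxb
  have htip : tip ∉ X := by
    intro h
    refine (hlt tip h (by simp)).ne ?_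
    rw [← hsupp]
    congr 1
    ext e
    simp [mem_coneSupp]
  -- The only element of `X` over `e` is `copy e i`, if that lies in `X`.
  have huniq : ∀ e i, ConeElt.copy e i ∈ X → ∀ o, coneOver e o ∈ X → o = some i := by
    intro e i hi o ho
    by_contra hne
    refine (hlt _ hi (by simp)).ne ?_
    rw [← hsupp]
    congr 1
    refine (coneSupp_mono sdiff_subset).antisymm fun a ha => ?_
    rw [mem_coneSupp_iff_coneOver] at ha ⊢
    obtain ⟨o', ho'⟩ := ha
    by_cases hae : a = e
    · subst hae
      refine ⟨o, ho, fun h => hne ?_⟩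
      exact (coneOver_injective2 (show coneOver a o = coneOver a (some i) from h)).2
    · refine ⟨o', ho', fun h => hae ?_⟩
      exact (coneOver_injective2 (show coneOver a o' = coneOver e (some i) from h)).1
  have hcoloop : ∀ e i, ConeElt.copy e i ∈ X → e ∈ (M ↾ (S : Set α)).coloops := by
    intro e i hi
    have heS : e ∈ (S : Set α) := hsupp ▸ Or.inr ⟨i, hi⟩
    refine (restrict_isColoop_iff hS).2 ⟨fun hcl => ?_, heS⟩
    have h₁ := (mem_closure_iff_natRk (hS heS)).1 hcl
    rw [insert_sdiff_singleton, insert_eq_of_mem heS] at h₁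
    have h₂ := hlt _ hi (by simp)
    have h₃ : (S : Set α) \ {e} ⊆ coneSupp ((X : Set (ConeElt α m)) \ {ConeElt.copy e i}) := by
      rintro a ⟨haS, hae⟩
      rw [← hsupp, mem_coneSupp_iff_coneOver] at haS
      rw [mem_coneSupp_iff_coneOver]
      obtain ⟨o, ho⟩ := haS
      refine ⟨o, ho, fun h => hae ?_⟩
      exact (coneOver_injective2 (show coneOver a o = coneOver e (some i) from h)).1
    have h₄ := M.natRk_mono h₃
    omega
  have hex : ∀ e ∈ S, ∃ o, coneOver e o ∈ X := fun e he => by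
    have he' : e ∈ coneSupp (X : Set (ConeElt α m)) := hsupp ▸ he
    exact mem_coneSupp_iff_coneOver.1 he'
  choose p hp using hex
  refine ⟨p, fun e he hK => ?_, ?_⟩
  · by_contra hne
    obtain ⟨i, hi⟩ := Option.ne_none_iff_exists'.1 hne
    have h := hp e he
    rw [hi] at h
    exact hK (hcoloop e i h)
  · ext x
    rcases eq_tip_or_coneOver x with rfl | ⟨e, o, rfl⟩
    · exact iff_of_false tip_notMem_coneSection htip
    rw [coneOver_mem_coneSection]
    refine ⟨fun ⟨h, ho⟩ => ho ▸ hp e h, fun ho => ?_⟩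
    have he : e ∈ S := by
      rw [← Finset.mem_coe, ← hsupp, mem_coneSupp_iff_coneOver]
      exact ⟨o, ho⟩
    refine ⟨he, ?_⟩
    rcases o with _ | i
    · rcases hpe : p e he with _ | j
      · rfl
      · have h := hp e he
        rw [hpe] at h
        exact absurd (huniq e j h none ho) (by simp)
    · exact huniq e i ho _ (hp e he)

open scoped Classical in
/-- The number of sets with support `S` and the same rank as `S`. -/
theorem card_filter_coneRk_eq {S : Finset α} (hS : (S : Set α) ⊆ M.E) :
    ((coneFiber m S).filter fun X : Finset (ConeElt α m) =>
        M.coneRk (X : Set (ConeElt α m)) = M.natRk (S : Set α)).card =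
      (m + 1) ^ (M ↾ (S : Set α)).coloops.ncard := by
  set K := (M ↾ (S : Set α)).coloops with hK
  let t : α → Finset (Option (Fin m)) := fun e => if e ∈ K then Finset.univ else {none}
  have ht : ∀ p : ∀ e ∈ S, Option (Fin m), p ∈ S.pi t ↔ ∀ e he, e ∉ K → p e he = none := by
    intro p
    rw [Finset.mem_pi]
    refine forall₂_congr fun e he => ?_
    by_cases h : e ∈ K <;> simp [t, h]
  have hcard : (S.pi t).card = (m + 1) ^ K.ncard := by
    have h₁ : ∀ e, (t e).card = if e ∈ K then m + 1 else 1 := fun e => by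
      by_cases h : e ∈ K <;> simp [t, h]
    have h₂ : ((S.filter (· ∈ K) : Finset α) : Set α) = K := by
      rw [Finset.coe_filter]
      ext e
      exact ⟨And.right, fun h => ⟨coloops_subset_ground (M ↾ (S : Set α)) h, h⟩⟩
    rw [Finset.card_pi, Finset.prod_congr rfl fun e _ => h₁ e, Finset.prod_ite, Finset.prod_const,
      Finset.prod_const_one, mul_one, ← ncard_coe_finset, h₂]
  rw [← hcard]
  refine (Finset.card_bij (fun p _ => coneSection S p) ?_ ?_ ?_).symm
  · intro p hp
    rw [Finset.mem_filter, mem_coneFiber]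
    exact ⟨coneSuppFinset_coneSection S p, coneRk_coneSection hS ((ht p).1 hp)⟩
  · intro p _ p' _ h
    funext e he
    have h₁ : coneOver e (p e he) ∈ coneSection S p' := h ▸ coneOver_mem_coneSection.2 ⟨he, rfl⟩
    obtain ⟨_, h₂⟩ := coneOver_mem_coneSection.1 h₁
    exact h₂.symm
  · intro X hX
    rw [Finset.mem_filter, mem_coneFiber] at hX
    obtain ⟨p, hp, hpX⟩ := exists_eq_coneSection hS hX.1 hX.2
    exact ⟨p, (ht p).2 hp, hpX⟩

end Section

/-! ### The Tutte polynomial of the free cone -/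

section Tutte

open MvPolynomial

/-- `∑_{j ≤ m} y ^ j`. -/
noncomputable def geomPoly (m : ℕ) : MvPolynomial (Fin 2) ℤ := ∑ j ∈ Finset.range (m + 1), X 1 ^ j

/-- The quotient of `∑_{j ≤ m} y ^ j - (m + 1)` by `y - 1`. -/
noncomputable def geomQuot (m : ℕ) : MvPolynomial (Fin 2) ℤ :=
  ∑ j ∈ Finset.range (m + 1), ∑ i ∈ Finset.range j, X 1 ^ i

/-- The quotient of `y * (∑_{j ≤ m} y ^ j) ^ s - (m + 1) ^ s` by `y - 1`. -/
noncomputable def powQuot (m : ℕ) : ℕ → MvPolynomial (Fin 2) ℤ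
  | 0 => 1
  | s + 1 => geomPoly m * powQuot m s + geomQuot m * (m + 1 : MvPolynomial (Fin 2) ℤ) ^ s

/-- The contribution to the Tutte polynomial of the free cone of the sets with support `S`, where
`s`, `ρ` and `c` are the size, the rank and the number of coloops of `S`, and `R` is the rank of
the matroid. The second summand is `(x - 1) ^ (R - ρ) * (y - 1) ^ (s - ρ)` times the quotient of
`y * (∑_{j ≤ m} y ^ j) ^ s - (m + 1) ^ c` by `y - 1`; if `s = ρ` then `c = s`. -/
noncomputable def coneTerm (m R s ρ c : ℕ) : MvPolynomial (Fin 2) ℤ :=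
  (X 0 - 1) ^ (R + 1 - ρ) * ((X 1 - 1) ^ (s - ρ) * (m + 1 : MvPolynomial (Fin 2) ℤ) ^ c) +
    (X 0 - 1) ^ (R - ρ) *
      if s = ρ then powQuot m s
      else (X 1 - 1) ^ (s - ρ - 1) * (X 1 * geomPoly m ^ s - (m + 1 : MvPolynomial (Fin 2) ℤ) ^ c)

theorem geomPoly_mul (m : ℕ) : geomPoly m * (X 1 - 1) = X 1 ^ (m + 1) - 1 :=
  geom_sum_mul _ _

theorem geomQuot_mul (m : ℕ) :
    geomQuot m * (X 1 - 1) = geomPoly m - (m + 1 : MvPolynomial (Fin 2) ℤ) := by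
  rw [geomQuot, Finset.sum_mul, Finset.sum_congr rfl fun j _ => geom_sum_mul _ j,
    Finset.sum_sub_distrib, geomPoly]
  simp

theorem powQuot_mul (m s : ℕ) :
    powQuot m s * (X 1 - 1) = X 1 * geomPoly m ^ s - (m + 1 : MvPolynomial (Fin 2) ℤ) ^ s := by
  induction s with
  | zero => simp [powQuot]
  | succ s ih =>
    rw [powQuot]
    linear_combination geomPoly m * ih + (m + 1 : MvPolynomial (Fin 2) ℤ) ^ s * geomQuot_mul m

variable {α : Type*} {m : ℕ} {M : Matroid α} [M.Finite]

theorem coneTerm_mul {R s ρ c : ℕ} (hρ : ρ ≤ s) (hc : s = ρ → c = s) :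
    coneTerm m R s ρ c * (X 1 - 1) ^ (ρ + 1) =
      (X 0 - 1) ^ (R + 1 - ρ) * (X 1 - 1) ^ (s + 1) * (m + 1 : MvPolynomial (Fin 2) ℤ) ^ c +
        (X 0 - 1) ^ (R - ρ) * (X 1 - 1) ^ s *
          (X 1 * geomPoly m ^ s - (m + 1 : MvPolynomial (Fin 2) ℤ) ^ c) := by
  rw [coneTerm]
  obtain ⟨k, rfl⟩ := Nat.exists_eq_add_of_le hρ
  split_ifs with h
  · have hk : k = 0 := by omega
    subst hk
    rw [hc h]
    simp only [add_zero, Nat.sub_self, pow_zero, one_mul]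
    linear_combination (X 0 - 1) ^ (R - ρ) * (X 1 - 1) ^ ρ * powQuot_mul m ρ
  · obtain ⟨j, rfl⟩ : ∃ j, k = j + 1 := ⟨k - 1, by omega⟩
    rw [show ρ + (j + 1) - ρ - 1 = j by omega, Nat.add_sub_cancel_left]
    ring

/-- The contribution of the sets with support `S` to the Tutte polynomial of the free cone. Such a
set has rank `r(S) + 1`, apart from the `(m + 1) ^ c` sets of size `|S|` whose rank is `r(S)`. -/
theorem sum_coneFiber {S : Finset α} (hS : (S : Set α) ⊆ M.E) :
    ∑ X ∈ coneFiber m S, (MvPolynomial.X 0 - 1) ^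
        (M.natRk M.E + 1 - M.coneRk (X : Set (ConeElt α m))) *
        (MvPolynomial.X 1 - 1) ^ (X.card - M.coneRk (X : Set (ConeElt α m))) =
      coneTerm m (M.natRk M.E) S.card (M.natRk (S : Set α))
        (M ↾ (S : Set α)).coloops.ncard := by
  classical
  set R := M.natRk M.E
  set ρ := M.natRk (S : Set α) with hρ
  set c := (M ↾ (S : Set α)).coloops.ncard with hc
  set u : MvPolynomial (Fin 2) ℤ := MvPolynomial.X 0 - 1 with hu
  set z : MvPolynomial (Fin 2) ℤ := MvPolynomial.X 1 - 1 with hz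
  have hz0 : z ≠ 0 := fun h => by
    have := congrArg (MvPolynomial.eval (0 : Fin 2 → ℤ)) h
    simp [hz] at this
  have hρs : ρ ≤ S.card := by
    rw [← ncard_coe_finset]
    exact M.natRk_le_ncard S.finite_toSet
  -- A set whose rank is its size is independent, so that all its elements are coloops.
  have hcs : S.card = ρ → c = S.card := by
    intro h
    have hle : S.card ≤ c := by
      rw [← ncard_coe_finset]
      refine ncard_le_ncard (fun e he => ?_)
        (S.finite_toSet.subset (coloops_subset_ground (M ↾ (S : Set α))))
      refine (restrict_isColoop_iff hS).2 ⟨fun hcl => ?_, he⟩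
      have h₁ := (mem_closure_iff_natRk (hS he)).1 hcl
      rw [insert_sdiff_singleton, insert_eq_of_mem he, ← hρ] at h₁
      have h₂ := M.natRk_le_ncard (S.finite_toSet.subset (sdiff_subset (t := {e})))
      rw [ncard_sdiff_singleton_of_mem he, ncard_coe_finset] at h₂
      have h₃ := Finset.card_pos.2 ⟨e, he⟩
      omega
    refine le_antisymm ?_ hle
    rw [← ncard_coe_finset]
    exact ncard_le_ncard (coloops_subset_ground (M ↾ (S : Set α))) S.finite_toSet
  -- Multiplied by this power, all terms become polynomials in `z ^ X.card`.
  refine mul_right_cancel₀ (pow_ne_zero (ρ + 1) hz0) ?_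
  rw [coneTerm_mul hρs hcs, Finset.sum_mul]
  have hterm : ∀ X ∈ coneFiber m S,
      u ^ (R + 1 - M.coneRk (X : Set (ConeElt α m))) *
          z ^ (X.card - M.coneRk (X : Set (ConeElt α m))) * z ^ (ρ + 1) =
        u ^ (R - ρ) * z ^ X.card +
          if M.coneRk (X : Set (ConeElt α m)) = ρ then
            u ^ (R + 1 - ρ) * z ^ (S.card + 1) - u ^ (R - ρ) * z ^ S.card else 0 := by
    intro X hX
    rw [mem_coneFiber] at hX
    have hsupp : coneSupp (X : Set (ConeElt α m)) = S := by rw [← coe_coneSuppFinset, hX]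
    have hXE : (X : Set (ConeElt α m)) ⊆ coneSet m M.E :=
      subset_coneSet_iff.2 (hsupp.symm ▸ hS)
    have h₁ : M.coneRk (X : Set (ConeElt α m)) ≤ X.card := by
      rw [← ncard_coe_finset]
      exact (isRankFn_coneRk (m := m) M).le_ncard _ hXE
    have h₂ : ρ ≤ M.coneRk (X : Set (ConeElt α m)) := by
      rw [hρ, ← hsupp]
      exact M.natRk_coneSupp_le_coneRk X.finite_toSet
    have h₃ : M.coneRk (X : Set (ConeElt α m)) ≤ ρ + 1 := by
      rw [hρ, ← hsupp]
      exact min_le_left _ _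
    split_ifs with h
    · obtain ⟨p, -, rfl⟩ := exists_eq_coneSection hS hX h
      rw [h, card_coneSection, mul_assoc, ← pow_add,
        show S.card - ρ + (ρ + 1) = S.card + 1 by omega]
      ring
    · have h₄ : M.coneRk (X : Set (ConeElt α m)) = ρ + 1 := by omega
      rw [h₄, mul_assoc, ← pow_add, show X.card - (ρ + 1) + (ρ + 1) = X.card by omega,
        Nat.add_sub_add_right, add_zero]
  rw [Finset.sum_congr rfl hterm, Finset.sum_add_distrib, ← Finset.mul_sum,
    sum_coneFiber_pow_card, ← Finset.sum_filter, Finset.sum_const, card_filter_coneRk_eq hS,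
    ← hc, nsmul_eq_mul, show 1 + z = MvPolynomial.X 1 by rw [hz]; ring, ← geomPoly_mul, ← hz,
    ← hu, mul_pow]
  push_cast
  ring

theorem tuttePoly_freeCone : (freeCone m M).tuttePoly =
    ∑ S ∈ M.ground_finite.toFinset.powerset, coneTerm m (M.natRk M.E) S.card
      (M.natRk (S : Set α)) (M ↾ (S : Set α)).coloops.ncard := by
  have hE : (freeCone m M).ground_finite.toFinset = coneFinset m M.ground_finite.toFinset := by
    rw [← Finset.coe_inj, coe_coneFinset, Finite.coe_toFinset, Finite.coe_toFinset, freeCone_E]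
  have hR : (freeCone m M).natRk (freeCone m M).E = M.natRk M.E + 1 := by
    rw [freeCone_E, natRk_freeCone M subset_rfl, coneRk_coneSet M M.ground_finite]
  rw [tuttePoly, hE, hR]
  have hX : ∀ X ∈ (coneFinset m M.ground_finite.toFinset).powerset,
      (freeCone m M).natRk (X : Set (ConeElt α m)) = M.coneRk (X : Set (ConeElt α m)) := by
    intro X hX
    refine natRk_freeCone M ?_
    rw [Finset.mem_powerset, ← Finset.coe_subset, coe_coneFinset, Finite.coe_toFinset] at hX
    exact hX
  rw [Finset.sum_congr rfl fun X h => by rw [hX X h], sum_powerset_coneFinset]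
  refine Finset.sum_congr rfl fun S hS => sum_coneFiber ?_
  simpa [← Finset.coe_subset] using hS

end Tutte

end Matroid

namespace Matroid

/-! ### Polynomials as lists of signed monomials -/

section SignedTerms

open MvPolynomial

/-- The polynomial with list `L` of signed monomials: the triple `(b, i, j)` stands for
`x ^ i * y ^ j` if `b` is `false`, and for `-x ^ i * y ^ j` if `b` is `true`. In this form,
multiplication does not need the arithmetic of integers. -/
noncomputable def polyOfSigned (L : List (Bool × ℕ × ℕ)) : MvPolynomial (Fin 2) ℤ :=
  (L.map fun t => (bif t.1 then -1 else 1) * X 0 ^ t.2.1 * X 1 ^ t.2.2).sum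

/-- The product of two lists of signed monomials. -/
def signedMul (L₁ L₂ : List (Bool × ℕ × ℕ)) : List (Bool × ℕ × ℕ) :=
  L₁.flatMap fun a => L₂.map fun b => (a.1.xor b.1, a.2.1 + b.2.1, a.2.2 + b.2.2)

/-- The powers of a list of signed monomials. -/
def signedPow (L : List (Bool × ℕ × ℕ)) (n : ℕ) : List (Bool × ℕ × ℕ) :=
  Nat.rec [(false, 0, 0)] (fun _ P => signedMul L P) n

/-- The negative of a list of signed monomials. -/
def signedNeg (L : List (Bool × ℕ × ℕ)) : List (Bool × ℕ × ℕ) :=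
  L.map fun t => (!t.1, t.2)

/-- The list for `y`. -/
def signedY : List (Bool × ℕ × ℕ) := [(false, 0, 1)]

/-- The list for `x - 1`. -/
def signedXSubOne : List (Bool × ℕ × ℕ) := [(false, 1, 0), (true, 0, 0)]

/-- The list for `y - 1`. -/
def signedYSubOne : List (Bool × ℕ × ℕ) := [(false, 0, 1), (true, 0, 0)]

/-- The list for the constant `m + 1`. -/
def signedSucc (m : ℕ) : List (Bool × ℕ × ℕ) := (List.range (m + 1)).map fun _ => (false, 0, 0)

/-- The list for `geomPoly`. -/
def signedGeom (m : ℕ) : List (Bool × ℕ × ℕ) := (List.range (m + 1)).map fun j => (false, 0, j)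

/-- The list for `geomQuot`. -/
def signedGeomQuot (m : ℕ) : List (Bool × ℕ × ℕ) :=
  (List.range (m + 1)).flatMap fun j => (List.range j).map fun i => (false, 0, i)

/-- The list for `powQuot`. -/
def signedPowQuot (m s : ℕ) : List (Bool × ℕ × ℕ) :=
  Nat.rec [(false, 0, 0)] (fun n D => signedMul (signedGeom m) D ++
    signedMul (signedGeomQuot m) (signedPow (signedSucc m) n)) s

/-- The list for `coneTerm`, where the arguments are `(m, R)` and `(s, ρ, c)`. -/
def signedConeTerm (a : ℕ × ℕ) (t : ℕ × ℕ × ℕ) : List (Bool × ℕ × ℕ) :=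
  signedMul (signedPow signedXSubOne (a.2 + 1 - t.2.1))
      (signedMul (signedPow signedYSubOne (t.1 - t.2.1)) (signedPow (signedSucc a.1) t.2.2)) ++
    signedMul (signedPow signedXSubOne (a.2 - t.2.1))
      (if t.1 = t.2.1 then signedPowQuot a.1 t.1
      else signedMul (signedPow signedYSubOne (t.1 - t.2.1 - 1))
        (signedMul signedY (signedPow (signedGeom a.1) t.1) ++
          signedNeg (signedPow (signedSucc a.1) t.2.2)))

/-- The largest second entry of the triples in a list. -/
def maxRank (data : List (ℕ × ℕ × ℕ)) : ℕ := data.foldr (fun t n => max t.2.1 n) 0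

/-- The terms of the Tutte polynomial of the free `m`-cone, computed from a list of the
size-rank-coloop data. -/
def coneTutteTerms (m : ℕ) (data : List (ℕ × ℕ × ℕ)) : List (ℕ × ℕ × ℤ) :=
  (data.flatMap (signedConeTerm (m, maxRank data))).map fun t =>
    (t.2.1, t.2.2, bif t.1 then -1 else 1)

theorem sum_map_range {R : Type*} [AddCommMonoid R] (f : ℕ → R) (n : ℕ) :
    ((List.range n).map f).sum = ∑ i ∈ Finset.range n, f i := by
  rw [Finset.sum, Finset.range_val, Multiset.range, Multiset.map_coe, Multiset.sum_coe]

variable (L L₁ L₂ : List (Bool × ℕ × ℕ))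

theorem polyOfTerms_map_signed :
    polyOfTerms (L.map fun t => (t.2.1, t.2.2, bif t.1 then -1 else 1)) = polyOfSigned L := by
  rw [polyOfTerms, polyOfSigned, List.map_map]
  congr 2
  funext ⟨b, i, j⟩
  cases b <;> simp

@[simp]
theorem polyOfSigned_append :
    polyOfSigned (L₁ ++ L₂) = polyOfSigned L₁ + polyOfSigned L₂ := by
  simp [polyOfSigned]

theorem polyOfSigned_flatMap {β : Type*} (l : List β) (f : β → List (Bool × ℕ × ℕ)) :
    polyOfSigned (l.flatMap f) = (l.map fun b => polyOfSigned (f b)).sum := by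
  induction l with
  | nil => simp [polyOfSigned]
  | cons b l ih => rw [List.flatMap_cons, polyOfSigned_append, ih, List.map_cons, List.sum_cons]

@[simp]
theorem polyOfSigned_signedMul :
    polyOfSigned (signedMul L₁ L₂) = polyOfSigned L₁ * polyOfSigned L₂ := by
  rw [signedMul, polyOfSigned_flatMap, polyOfSigned, ← List.sum_map_mul_right]
  congr 2
  funext a
  rw [polyOfSigned, polyOfSigned, ← List.sum_map_mul_left, List.map_map]
  congr 2
  funext b
  rcases a with ⟨_ | _, i, j⟩ <;> rcases b with ⟨_ | _, k, l⟩ <;> simp <;> ring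

@[simp]
theorem polyOfSigned_one : polyOfSigned [(false, 0, 0)] = 1 := by simp [polyOfSigned]

@[simp]
theorem polyOfSigned_signedPow (n : ℕ) :
    polyOfSigned (signedPow L n) = polyOfSigned L ^ n := by
  induction n with
  | zero => exact polyOfSigned_one
  | succ n ih => rw [pow_succ', ← ih, ← polyOfSigned_signedMul]; rfl

@[simp]
theorem polyOfSigned_signedNeg : polyOfSigned (signedNeg L) = -polyOfSigned L := by
  rw [polyOfSigned, polyOfSigned, signedNeg, List.map_map, List.sum_neg, List.map_map]
  congr 2
  funext ⟨b, i, j⟩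
  cases b <;> simp

@[simp]
theorem polyOfSigned_signedY : polyOfSigned signedY = X 1 := by simp [polyOfSigned, signedY]

@[simp]
theorem polyOfSigned_signedXSubOne : polyOfSigned signedXSubOne = X 0 - 1 := by
  simp [polyOfSigned, signedXSubOne, sub_eq_add_neg]

@[simp]
theorem polyOfSigned_signedYSubOne : polyOfSigned signedYSubOne = X 1 - 1 := by
  simp [polyOfSigned, signedYSubOne, sub_eq_add_neg]

@[simp]
theorem polyOfSigned_signedSucc (m : ℕ) : polyOfSigned (signedSucc m) = m + 1 := by
  simp [polyOfSigned, signedSucc]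

@[simp]
theorem polyOfSigned_signedGeom (m : ℕ) : polyOfSigned (signedGeom m) = geomPoly m := by
  simp [polyOfSigned, signedGeom, geomPoly, Function.comp_def, sum_map_range]

@[simp]
theorem polyOfSigned_signedGeomQuot (m : ℕ) :
    polyOfSigned (signedGeomQuot m) = geomQuot m := by
  rw [signedGeomQuot, polyOfSigned_flatMap]
  simp [polyOfSigned, geomQuot, Function.comp_def, sum_map_range]

@[simp]
theorem polyOfSigned_signedPowQuot (m s : ℕ) :
    polyOfSigned (signedPowQuot m s) = powQuot m s := by
  induction s with
  | zero => exact polyOfSigned_one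
  | succ s ih =>
    rw [powQuot, ← ih, ← polyOfSigned_signedGeom, ← polyOfSigned_signedGeomQuot,
      ← polyOfSigned_signedSucc, ← polyOfSigned_signedPow, ← polyOfSigned_signedMul,
      ← polyOfSigned_signedMul, ← polyOfSigned_append]
    rfl

theorem polyOfSigned_signedConeTerm (a : ℕ × ℕ) (t : ℕ × ℕ × ℕ) :
    polyOfSigned (signedConeTerm a t) = coneTerm a.1 a.2 t.1 t.2.1 t.2.2 := by
  rw [signedConeTerm, coneTerm]
  split_ifs <;> simp [sub_eq_add_neg]

theorem polyOfTerms_coneTutteTerms (m : ℕ) (data : List (ℕ × ℕ × ℕ)) :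
    polyOfTerms (coneTutteTerms m data) =
      (data.map fun t => coneTerm m (maxRank data) t.1 t.2.1 t.2.2).sum := by
  simp only [coneTutteTerms, polyOfTerms_map_signed, polyOfSigned_flatMap,
    polyOfSigned_signedConeTerm]

theorem maxRank_eq {data : List (ℕ × ℕ × ℕ)} {R : ℕ} (hle : ∀ t ∈ data, t.2.1 ≤ R)
    (hmem : ∃ t ∈ data, t.2.1 = R) : maxRank data = R := by
  refine le_antisymm ?_ ?_
  · clear hmem
    induction data with
    | nil => exact Nat.zero_le R
    | cons a l ih =>
      exact max_le (hle a List.mem_cons_self) (ih fun t ht => hle t (List.mem_cons_of_mem a ht))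
  · clear hle
    obtain ⟨t, ht, rfl⟩ := hmem
    induction data with
    | nil => cases ht
    | cons a l ih =>
      rcases List.mem_cons.1 ht with rfl | ht
      exacts [le_max_left _ _, (ih ht).trans (le_max_right _ _)]

end SignedTerms

/-! ### Computability -/

section Computability

theorem primrec_signedMul : Primrec₂ signedMul := by
  refine Primrec.list_flatMap Primrec.fst (Primrec.list_map (Primrec.snd.comp Primrec.fst) ?_)
  have ha : Primrec fun q : ((List (Bool × ℕ × ℕ) × List (Bool × ℕ × ℕ)) × (Bool × ℕ × ℕ)) ×
      (Bool × ℕ × ℕ) => q.1.2 := Primrec.snd.comp Primrec.fst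
  have hb : Primrec fun q : ((List (Bool × ℕ × ℕ) × List (Bool × ℕ × ℕ)) × (Bool × ℕ × ℕ)) ×
      (Bool × ℕ × ℕ) => q.2 := Primrec.snd
  exact ((Primrec.dom_bool₂ Bool.xor).comp (Primrec.fst.comp ha) (Primrec.fst.comp hb)).pair
    ((Primrec.nat_add.comp (Primrec.fst.comp (Primrec.snd.comp ha))
      (Primrec.fst.comp (Primrec.snd.comp hb))).pair
    (Primrec.nat_add.comp (Primrec.snd.comp (Primrec.snd.comp ha))
      (Primrec.snd.comp (Primrec.snd.comp hb))))

theorem primrec_signedPow : Primrec₂ signedPow :=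
  Primrec.nat_rec (Primrec.const _)
    (primrec_signedMul.comp Primrec.fst (Primrec.snd.comp Primrec.snd)).to₂

theorem primrec_signedNeg : Primrec signedNeg :=
  Primrec.list_map Primrec.id
    ((Primrec.not.comp (Primrec.fst.comp Primrec.snd)).pair (Primrec.snd.comp Primrec.snd))

theorem primrec_signedSucc : Primrec signedSucc :=
  Primrec.list_map (Primrec.list_range.comp Primrec.succ) (Primrec.const _)

theorem primrec_signedGeom : Primrec signedGeom :=
  Primrec.list_map (Primrec.list_range.comp Primrec.succ)
    ((Primrec.const false).pair ((Primrec.const 0).pair Primrec.snd))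

theorem primrec_signedGeomQuot : Primrec signedGeomQuot :=
  Primrec.list_flatMap (Primrec.list_range.comp Primrec.succ)
    (Primrec.list_map (Primrec.list_range.comp Primrec.snd)
      ((Primrec.const false).pair ((Primrec.const 0).pair Primrec.snd)))

theorem primrec_signedPowQuot : Primrec₂ signedPowQuot :=
  Primrec.nat_rec (Primrec.const _) (Primrec.list_append.comp
    (primrec_signedMul.comp (primrec_signedGeom.comp Primrec.fst)
      (Primrec.snd.comp Primrec.snd))
    (primrec_signedMul.comp (primrec_signedGeomQuot.comp Primrec.fst)
      (primrec_signedPow.comp (primrec_signedSucc.comp Primrec.fst)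
        (Primrec.fst.comp Primrec.snd)))).to₂

theorem primrec_signedConeTerm : Primrec₂ signedConeTerm := by
  have hm : Primrec fun q : (ℕ × ℕ) × ℕ × ℕ × ℕ => q.1.1 := Primrec.fst.comp Primrec.fst
  have hR : Primrec fun q : (ℕ × ℕ) × ℕ × ℕ × ℕ => q.1.2 := Primrec.snd.comp Primrec.fst
  have hs : Primrec fun q : (ℕ × ℕ) × ℕ × ℕ × ℕ => q.2.1 := Primrec.fst.comp Primrec.snd
  have hρ : Primrec fun q : (ℕ × ℕ) × ℕ × ℕ × ℕ => q.2.2.1 :=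
    Primrec.fst.comp (Primrec.snd.comp Primrec.snd)
  have hc : Primrec fun q : (ℕ × ℕ) × ℕ × ℕ × ℕ => q.2.2.2 :=
    Primrec.snd.comp (Primrec.snd.comp Primrec.snd)
  have hpow := primrec_signedPow.comp (primrec_signedSucc.comp hm) hc
  refine Primrec.list_append.comp
    (primrec_signedMul.comp
      (primrec_signedPow.comp (Primrec.const _)
        (Primrec.nat_sub.comp (Primrec.succ.comp hR) hρ))
      (primrec_signedMul.comp
        (primrec_signedPow.comp (Primrec.const _) (Primrec.nat_sub.comp hs hρ)) hpow))
    (primrec_signedMul.comp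
      (primrec_signedPow.comp (Primrec.const _) (Primrec.nat_sub.comp hR hρ))
      (Primrec.ite (Primrec.eq.comp hs hρ) (primrec_signedPowQuot.comp hm hs)
        (primrec_signedMul.comp
          (primrec_signedPow.comp (Primrec.const _)
            (Primrec.nat_sub.comp (Primrec.nat_sub.comp hs hρ) (Primrec.const 1)))
          (Primrec.list_append.comp
            (primrec_signedMul.comp (Primrec.const _)
              (primrec_signedPow.comp (primrec_signedGeom.comp hm) hs))
            (primrec_signedNeg.comp hpow)))))

theorem primrec_maxRank : Primrec maxRank :=
  Primrec.list_foldr Primrec.id (Primrec.const 0)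
    (Primrec.nat_max.comp
      (Primrec.fst.comp (Primrec.snd.comp (Primrec.fst.comp Primrec.snd)))
      (Primrec.snd.comp Primrec.snd)).to₂

theorem computable₂_coneTutteTerms : Computable₂ coneTutteTerms := by
  have h : Primrec fun q : ℕ × List (ℕ × ℕ × ℕ) => coneTutteTerms q.1 q.2 :=
    Primrec.list_map
      (Primrec.list_flatMap Primrec.snd
        (primrec_signedConeTerm.comp
          ((Primrec.fst.comp Primrec.fst).pair
            (primrec_maxRank.comp (Primrec.snd.comp Primrec.fst))) Primrec.snd))
      ((Primrec.fst.comp (Primrec.snd.comp Primrec.snd)).pair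
        ((Primrec.snd.comp (Primrec.snd.comp Primrec.snd)).pair
          ((Primrec.dom_bool fun b => bif b then (-1 : ℤ) else 1).comp
            (Primrec.fst.comp Primrec.snd))))
  exact h.to_comp

end Computability

theorem tuttePoly_freeCone_eq_polyOfTerms {α : Type*} {M : Matroid α} [M.Finite] (m : ℕ)
    {data : List (ℕ × ℕ × ℕ)} (hdata : (data : Multiset (ℕ × ℕ × ℕ)) = M.sizeRankColoopData) :
    (freeCone m M).tuttePoly = polyOfTerms (coneTutteTerms m data) := by
  have hmem : ∀ t, t ∈ data ↔ ∃ S ⊆ M.ground_finite.toFinset,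
      (S.card, M.natRk (S : Set α), (M ↾ (S : Set α)).coloops.ncard) = t := by
    intro t
    rw [← Multiset.mem_coe, hdata, sizeRankColoopData, Multiset.mem_map]
    simp only [Finset.mem_val, Finset.mem_powerset]
  have hR : maxRank data = M.natRk M.E := by
    refine maxRank_eq (fun t ht => ?_) ⟨_, (hmem _).2 ⟨_, subset_rfl, rfl⟩, by simp⟩
    obtain ⟨S, hS, rfl⟩ := (hmem t).1 ht
    exact M.natRk_mono (by simpa [← Finset.coe_subset] using hS)
  rw [polyOfTerms_coneTutteTerms, hR, tuttePoly_freeCone, ← Multiset.sum_coe, ← Multiset.map_coe,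
    hdata, sizeRankColoopData, Multiset.map_map]
  rfl

end Matroid

theorem theorem5p1 :
    ∃ F : ℕ → List (ℕ × ℕ × ℕ) → List (ℕ × ℕ × ℤ), Computable₂ F ∧
      ∀ (m : ℕ), 1 ≤ m → ∀ (α : Type*) (M : Matroid α) [M.Finite] [M.Loopless],
        (∃! Q : Matroid (Matroid.ConeElt α m), Matroid.IsFreeCone m M Q) ∧
        ∀ (Q : Matroid (Matroid.ConeElt α m)) (hQ : Matroid.IsFreeCone m M Q)
          (data : List (ℕ × ℕ × ℕ)), (data : Multiset (ℕ × ℕ × ℕ)) = M.sizeRankColoopData →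
            haveI : Q.Finite := hQ.finite
            Q.tuttePoly = Matroid.polyOfTerms (F m data) := by
  refine ⟨Matroid.coneTutteTerms, Matroid.computable₂_coneTutteTerms, fun m hm α M _ _ =>
    ⟨⟨Matroid.freeCone m M, Matroid.isFreeCone_freeCone M hm, fun Q hQ => hQ.eq_freeCone M hm⟩, ?_⟩⟩
  intro Q hQ data hdata
  obtain rfl := hQ.eq_freeCone M hm
  exact Matroid.tuttePoly_freeCone_eq_polyOfTerms m hdata
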